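/- Let $n\ge 0$ and $m,r\ge 1$ be integers, $1\le p<\infty$, $-\infty<a<b<\infty$ and $\varepsilon_0>0$. Let $W_p^n=W_p^n([a,b],\mathbb C)$ be the complex Sobolev space of functions in $L_p([a,b],\mathbb C)$ whose weak derivatives up to order $n$ lie in $L_p$, with the norm $\|x\|_{n,p}=\bigl(\sum_{j=0}^n\int_a^b|x^{(j)}(t)|^p\,dt\bigr)^{1/p}$. The spaces $(W_p^n)^m$ and $(W_p^n)^{m\times m}$ of vector-valued and matrix-valued functions are normed by the sum of the norms of the components. For every $\varepsilon\in[0,\varepsilon_0)$ let $A_0(\cdot,\varepsilon),\dots,A_{r-1}(\cdot,\varepsilon)\in(W_p^n)^{m\times m}$ and let $B(\varepsilon):(W_p^{n+r})^m\to\mathbb C^{rm}$ be an arbitrary continuous linear operator; no regularity in $\varepsilon$ is assumed. For $f(\cdot,\varepsilon)\in(W_p^n)^m$ and $c(\varepsilon)\in\mathbb C^{rm}$ consider the boundary-value problem for $y(\cdot,\varepsilon)\in(W_p^{n+r})^m$ $$L(\varepsilon)y(t,\varepsilon):=y^{(r)}(t,\varepsilon)+\sum_{j=1}^{r}A_{r-j}(t,\varepsilon)\,y^{(r-j)}(t,\varepsilon)=f(t,\varepsilon),\quad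 a\le t\le b,\qquad B(\varepsilon)y(\cdot,\varepsilon)=c(\varepsilon),$$ where the differential equation is understood almost everywhere on $[a,b]$ (if $n\ge1$ this is the same as everywhere on $[a,b]$ for the continuous representatives). We say that the solution depends continuously on the parameter $\varepsilon$ at $\varepsilon=0$ if there is a positive number $\varepsilon_1<\varepsilon_0$ such that - $(\ast)$ for all $\varepsilon\in[0,\varepsilon_1)$, $f(\cdot,\varepsilon)\in(W_p^n)^m$ and $c(\varepsilon)\in\mathbb C^{rm}$ the problem has a unique solution $y(\cdot,\varepsilon)\in(W_p^{n+r})^m$; and - $(\ast\ast)$ whenever $f(\cdot,\varepsilon)\to f(\cdot,0)$ in $(W_p^n)^m$ and $c(\varepsilon)\to c(0)$ in $\mathbb C^{rm}$ as $\varepsilon\to0+$, the solutions satisfy $y(\cdot,\varepsilon)\to y(\cdot,0)$ in $(W_p^{n+r})^m$ as $\varepsilon\to0+$. **Theorem.** The solution depends continuously on the parameter $\varepsilon$ at $\varepsilon=0$ if and only if the following three conditions hold: - (0) the homogeneous limiting problem $L(0)y=0$, $B(0)y=0$ has only the trivial solution in $(W_p^{n+r})^m$; - (I) $A_{r-j}(\cdot,\varepsilon)\to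 A_{r-j}(\cdot,0)$ in $(W_p^n)^{m\times m}$ as $\varepsilon\to0+$ for each $j\in\{1,\dots,r\}$; - (II) $B(\varepsilon)y\to B(0)y$ in $\mathbb C^{rm}$ as $\varepsilon\to0+$ for every $y\in(W_p^{n+r})^m$. -/

import Mathlib

open MeasureTheory Set Filter Topology
open scoped ENNReal ContDiff

noncomputable section

/-- The complex Lebesgue space `L_p([a,b], ℂ)`. -/
abbrev LpI (a b : ℝ) (p : ℝ≥0∞) : Type :=
  Lp ℂ p (volume.restrict (Icc a b))

/-- `v` is the weak derivative of order `k` of `u` on the interval `(a,b)`. -/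
def HasWeakDeriv (a b : ℝ) (k : ℕ) (u v : ℝ → ℂ) : Prop :=
  ∀ φ : ℝ → ℝ, ContDiff ℝ ∞ φ → HasCompactSupport φ → tsupport φ ⊆ Ioo a b →
    ∫ t in Icc a b, iteratedDeriv k φ t • u t = (-1) ^ k * ∫ t in Icc a b, φ t • v t

section helpers

variable {a b : ℝ} {p : ℝ≥0∞}

theorem continuous_iteratedDeriv_test {φ : ℝ → ℝ} (hφ : ContDiff ℝ ∞ φ) (k : ℕ) :
    Continuous (iteratedDeriv k φ) :=
  hφ.continuous_iteratedDeriv k (by exact_mod_cast le_top)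

theorem integrable_smul_Lp [hp : Fact (1 ≤ p)] {g : ℝ → ℝ} (hg : Continuous g) (u : LpI a b p) :
    Integrable (fun t => g t • u t) (volume.restrict (Icc a b)) := by
  have hu : IntegrableOn (u : ℝ → ℂ) (Icc a b) := (Lp.memLp u).integrable hp.out
  exact hu.continuousOn_smul hg.continuousOn isCompact_Icc

theorem HasWeakDeriv.add [Fact (1 ≤ p)] {k : ℕ} {u₁ u₂ v₁ v₂ : LpI a b p}
    (h₁ : HasWeakDeriv a b k u₁ v₁) (h₂ : HasWeakDeriv a b k u₂ v₂) :
    HasWeakDeriv a b k ((u₁ + u₂ : LpI a b p) : ℝ → ℂ) ((v₁ + v₂ : LpI a b p) : ℝ → ℂ) := by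
  have key : ∀ (g : ℝ → ℝ), Continuous g → ∀ w₁ w₂ : LpI a b p,
      ∫ t in Icc a b, g t • (w₁ + w₂ : LpI a b p) t =
        (∫ t in Icc a b, g t • w₁ t) + ∫ t in Icc a b, g t • w₂ t := by
    intro g hg w₁ w₂
    rw [← integral_add (integrable_smul_Lp hg w₁) (integrable_smul_Lp hg w₂)]
    refine integral_congr_ae ?_
    filter_upwards [Lp.coeFn_add w₁ w₂] with t ht
    rw [ht, Pi.add_apply, smul_add]
  intro φ h1 h2 h3
  rw [key _ (continuous_iteratedDeriv_test h1 k), key _ h1.continuous,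
    h₁ φ h1 h2 h3, h₂ φ h1 h2 h3, mul_add]

theorem HasWeakDeriv.smul {k : ℕ} {u v : LpI a b p} (c : ℂ)
    (h : HasWeakDeriv a b k u v) :
    HasWeakDeriv a b k ((c • u : LpI a b p) : ℝ → ℂ) ((c • v : LpI a b p) : ℝ → ℂ) := by
  have key : ∀ (g : ℝ → ℝ) (w : LpI a b p),
      ∫ t in Icc a b, g t • (c • w : LpI a b p) t = c * ∫ t in Icc a b, g t • w t := by
    intro g w
    rw [← integral_const_mul]
    refine integral_congr_ae ?_
    filter_upwards [Lp.coeFn_smul c w] with t ht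
    rw [ht, Pi.smul_apply, smul_eq_mul, mul_smul_comm]
  intro φ h1 h2 h3
  rw [key, key, h φ h1 h2 h3, mul_left_comm]

/-- Weak derivatives are unique. -/
theorem HasWeakDeriv.unique [hp : Fact (1 ≤ p)] {k : ℕ} {u : ℝ → ℂ} {v₁ v₂ : LpI a b p}
    (h₁ : HasWeakDeriv a b k u v₁) (h₂ : HasWeakDeriv a b k u v₂) : v₁ = v₂ := by
  have hi : ∀ w : LpI a b p, IntegrableOn (w : ℝ → ℂ) (Icc a b) :=
    fun w => (Lp.memLp w).integrable hp.out
  have hz : ∀ᵐ t ∂(volume : Measure ℝ), t ∈ Ioo a b → v₁ t - v₂ t = 0 := by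
    refine isOpen_Ioo.ae_eq_zero_of_integral_contDiff_smul_eq_zero
      (f := fun t => v₁ t - v₂ t) ?_ ?_
    · exact (((hi v₁).sub (hi v₂)).mono_set Ioo_subset_Icc_self).locallyIntegrableOn
    · intro φ h1 h2 h3
      have hsupp : ∀ t, t ∉ Icc a b → φ t • (v₁ t - v₂ t) = 0 := by
        intro t ht
        have : t ∉ tsupport φ := fun h => ht (Ioo_subset_Icc_self (h3 h))
        rw [image_eq_zero_of_notMem_tsupport this, zero_smul]
      rw [← setIntegral_eq_integral_of_forall_compl_eq_zero hsupp]
      simp_rw [smul_sub]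
      rw [integral_sub (integrable_smul_Lp h1.continuous v₁)
        (integrable_smul_Lp h1.continuous v₂), sub_eq_zero]
      have h := (h₁ φ h1 h2 h3).symm.trans (h₂ φ h1 h2 h3)
      exact mul_left_cancel₀ (pow_ne_zero _ (by norm_num)) h
  refine Lp.ext ?_
  have hIoo : ∀ᵐ t ∂(volume.restrict (Icc a b)), t ∈ Ioo a b := by
    rw [← restrict_Ioo_eq_restrict_Icc]
    exact ae_restrict_mem measurableSet_Ioo
  filter_upwards [ae_restrict_of_ae hz, hIoo] with t ht htm using sub_eq_zero.1 (ht htm)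

theorem hasWeakDeriv_zero_self (u : ℝ → ℂ) : HasWeakDeriv a b 0 u u := by
  intro φ _ _ _
  simp

end helpers

/-- The functions of `L_p([a,b], ℂ)` that have weak derivatives of all orders `k ≤ n`
in `L_p([a,b], ℂ)`, as a linear subspace of `L_p([a,b], ℂ)`. -/
def sobolevSubmodule (a b : ℝ) (n : ℕ) (p : ℝ≥0∞) [Fact (1 ≤ p)] :
    Submodule ℂ (LpI a b p) where
  carrier := {u | ∀ k ≤ n, ∃ v : LpI a b p, HasWeakDeriv a b k u v}
  zero_mem' := fun k _ => ⟨0, by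
    intro φ _ _ _
    have key : ∀ g : ℝ → ℝ, ∫ t in Icc a b, g t • (0 : LpI a b p) t = 0 := by
      intro g
      refine integral_eq_zero_of_ae ?_
      filter_upwards [Lp.coeFn_zero ℂ p (volume.restrict (Icc a b))] with t ht
      rw [ht, Pi.zero_apply, smul_zero]
    rw [key, key, mul_zero]⟩
  add_mem' := by
    intro u₁ u₂ h₁ h₂ k hk
    obtain ⟨v₁, hv₁⟩ := h₁ k hk
    obtain ⟨v₂, hv₂⟩ := h₂ k hk
    exact ⟨v₁ + v₂, hv₁.add hv₂⟩
  smul_mem' := by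
    intro c u h k hk
    obtain ⟨v, hv⟩ := h k hk
    exact ⟨c • v, hv.smul c⟩

/-- The complex Sobolev space `W_p^n([a,b], ℂ)`.  It is a type of its own since its norm is not
the one induced from `L_p`. -/
def Sobolev (a b : ℝ) (n : ℕ) (p : ℝ≥0∞) [Fact (1 ≤ p)] : Type :=
  sobolevSubmodule a b n p

namespace Sobolev

variable {a b : ℝ} {n : ℕ} {p : ℝ≥0∞} [Fact (1 ≤ p)]

instance instAddCommGroup : AddCommGroup (Sobolev a b n p) :=
  inferInstanceAs (AddCommGroup (sobolevSubmodule a b n p))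

instance instModule : Module ℂ (Sobolev a b n p) :=
  inferInstanceAs (Module ℂ (sobolevSubmodule a b n p))

/-- The underlying element of `L_p([a,b], ℂ)`. -/
def toLp : Sobolev a b n p →ₗ[ℂ] LpI a b p :=
  (sobolevSubmodule a b n p).subtype

theorem toLp_injective : Function.Injective (toLp : Sobolev a b n p → LpI a b p) :=
  Subtype.val_injective

theorem exists_weakDeriv (k : Fin (n + 1)) (u : Sobolev a b n p) :
    ∃ v : LpI a b p, HasWeakDeriv a b k (toLp u) v :=
  u.2 k (Nat.lt_succ_iff.1 k.2)

/-- The derivative `u ↦ u^(k)` of order `k ≤ n` from `W_p^n` to `L_p`. -/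
def weakDeriv (k : Fin (n + 1)) : Sobolev a b n p →ₗ[ℂ] LpI a b p where
  toFun u := (exists_weakDeriv k u).choose
  map_add' u₁ u₂ := by
    refine HasWeakDeriv.unique (exists_weakDeriv k (u₁ + u₂)).choose_spec ?_
    rw [map_add]
    exact (exists_weakDeriv k u₁).choose_spec.add (exists_weakDeriv k u₂).choose_spec
  map_smul' c u := by
    refine HasWeakDeriv.unique (exists_weakDeriv k (c • u)).choose_spec ?_
    rw [map_smul]
    exact (exists_weakDeriv k u).choose_spec.smul c

theorem hasWeakDeriv_weakDeriv (k : Fin (n + 1)) (u : Sobolev a b n p) :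
    HasWeakDeriv a b k (toLp u) (weakDeriv k u) :=
  (exists_weakDeriv k u).choose_spec

theorem weakDeriv_zero (u : Sobolev a b n p) : weakDeriv 0 u = toLp u :=
  (hasWeakDeriv_weakDeriv 0 u).unique (hasWeakDeriv_zero_self _)

/-- `u ↦ (u, u', …, u^(n))`, with values in the `ℓ_p`-sum of `n + 1` copies of `L_p`. -/
def jet : Sobolev a b n p →ₗ[ℂ] PiLp p (fun _ : Fin (n + 1) => LpI a b p) :=
  (WithLp.linearEquiv p ℂ (Fin (n + 1) → LpI a b p)).symm.toLinearMap ∘ₗ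
    LinearMap.pi weakDeriv

theorem jet_injective :
    Function.Injective (jet : Sobolev a b n p → PiLp p (fun _ : Fin (n + 1) => LpI a b p)) := by
  intro u₁ u₂ h
  have h0 : weakDeriv 0 u₁ = weakDeriv 0 u₂ :=
    congrArg (fun w : PiLp p (fun _ : Fin (n + 1) => LpI a b p) => w 0) h
  rw [weakDeriv_zero, weakDeriv_zero] at h0
  exact toLp_injective h0

/-- The Sobolev norm `‖u‖ = (∑_{k ≤ n} ∫_a^b |u^(k)(t)|^p dt)^(1/p)`. -/
instance instNormedAddCommGroup : NormedAddCommGroup (Sobolev a b n p) :=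
  NormedAddCommGroup.induced _ _ jet jet_injective

instance instNormedSpace : NormedSpace ℂ (Sobolev a b n p) :=
  NormedSpace.induced ℂ _ _ jet

end Sobolev

/-- `(W_p^n)^m`, normed by the sum of the norms of the components. -/
abbrev SobolevVec (a b : ℝ) (n : ℕ) (p : ℝ≥0∞) [Fact (1 ≤ p)] (m : ℕ) : Type :=
  PiLp 1 (fun _ : Fin m => Sobolev a b n p)

/-- `(W_p^n)^{m × m}`, normed by the sum of the norms of the entries. -/
abbrev SobolevMat (a b : ℝ) (n : ℕ) (p : ℝ≥0∞) [Fact (1 ≤ p)] (m : ℕ) : Type :=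
  PiLp 1 (fun _ : Fin m × Fin m => Sobolev a b n p)

section problem

variable {a b : ℝ} {n : ℕ} {p : ℝ≥0∞} [Fact (1 ≤ p)] {m r : ℕ}

/-- `y` is a solution in `(W_p^{n+r})^m` of the boundary-value problem
`y^(r) + ∑_{k < r} A_k y^(k) = f` almost everywhere on `[a,b]`, `B y = c`. -/
def IsSolution (A : Fin r → SobolevMat a b n p m)
    (B : SobolevVec a b (n + r) p m →L[ℂ] EuclideanSpace ℂ (Fin (r * m)))
    (f : SobolevVec a b n p m) (c : EuclideanSpace ℂ (Fin (r * m)))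
    (y : SobolevVec a b (n + r) p m) : Prop :=
  (∀ᵐ t ∂(volume.restrict (Icc a b)), ∀ i : Fin m,
    Sobolev.weakDeriv ⟨r, by omega⟩ (y i) t +
        ∑ k : Fin r, ∑ l : Fin m,
          Sobolev.toLp (A k (i, l)) t * Sobolev.weakDeriv ⟨k, by omega⟩ (y l) t =
      Sobolev.toLp (f i) t) ∧
  B y = c

/-- The solution to the problem with the left-hand sides `A ε`, `B ε`, `0 ≤ ε < ε₀`, depends
continuously on the parameter `ε` at `ε = 0`. -/
def SolutionDependsContinuously (ε₀ : ℝ) (A : ℝ → Fin r → SobolevMat a b n p m)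
    (B : ℝ → SobolevVec a b (n + r) p m →L[ℂ] EuclideanSpace ℂ (Fin (r * m))) : Prop :=
  ∃ ε₁ : ℝ, 0 < ε₁ ∧ ε₁ < ε₀ ∧
    (∀ ε ∈ Ico 0 ε₁, ∀ (f : SobolevVec a b n p m) (c : EuclideanSpace ℂ (Fin (r * m))),
      ∃! y : SobolevVec a b (n + r) p m, IsSolution (A ε) (B ε) f c y) ∧
    (∀ (f : ℝ → SobolevVec a b n p m) (c : ℝ → EuclideanSpace ℂ (Fin (r * m)))
      (y : ℝ → SobolevVec a b (n + r) p m),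
      (∀ ε ∈ Ico 0 ε₁, IsSolution (A ε) (B ε) (f ε) (c ε) (y ε)) →
      Tendsto f (𝓝[>] 0) (𝓝 (f 0)) → Tendsto c (𝓝[>] 0) (𝓝 (c 0)) →
      Tendsto y (𝓝[>] 0) (𝓝 (y 0)))

/-- The homogeneous limiting problem has only the trivial solution. -/
def ConditionZero (A : ℝ → Fin r → SobolevMat a b n p m)
    (B : ℝ → SobolevVec a b (n + r) p m →L[ℂ] EuclideanSpace ℂ (Fin (r * m))) : Prop :=
  ∀ y : SobolevVec a b (n + r) p m, IsSolution (A 0) (B 0) 0 0 y → y = 0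

/-- `A_k(·,ε) → A_k(·,0)` in `(W_p^n)^{m × m}` as `ε → 0+`, for every `k`. -/
def LimitConditionI (A : ℝ → Fin r → SobolevMat a b n p m) : Prop :=
  ∀ k : Fin r, Tendsto (fun ε => A ε k) (𝓝[>] 0) (𝓝 (A 0 k))

/-- `B(ε) → B(0)` strongly as `ε → 0+`. -/
def LimitConditionII
    (B : ℝ → SobolevVec a b (n + r) p m →L[ℂ] EuclideanSpace ℂ (Fin (r * m))) : Prop :=
  ∀ y : SobolevVec a b (n + r) p m, Tendsto (fun ε => B ε y) (𝓝[>] 0) (𝓝 (B 0 y))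

end problem

end

/-! Write `X = (W_p^{n+r})^m`, `Y = (W_p^n)^m`, and let `γ` map `y` to its Cauchy data at `a`. For
any coefficients the Cauchy problem is uniquely solvable, so `(L, γ) : X → Y × ℂ^{rm}` is an
isomorphism (`bijective_diffOp_prod_cauchyData`). This comes from a first-order companion system,
solved as a Volterra equation by a weighted contraction and then lifted in smoothness. The product
`W_p^n × W_p^{n+1} → W_p^n` is bounded, so `L` depends continuously on its coefficients in operator
norm.

Sufficiency. Under (I), `(L(ε), γ)` converges in norm, so it is eventually invertible with
converging inverses. Restricting `B(ε)` to `ker L(ε)`, parametrised by Cauchy data, gives maps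
`M(ε)` between spaces of dimension `rm`. By Banach–Steinhaus and (II) they converge pointwise, hence
in norm. By (0) the limit is injective, hence invertible. The boundary-value problem then has an
explicit solution in terms of these inverses, and the formula passes to the limit
(`bijective_and_tendsto_of_tendsto`).

Necessity. (0) is uniqueness at `ε = 0`. For (I), let `y_j(ε)` solve `L(ε) y = 0`, `B(ε) y = e_j`;
these solutions converge. The Wronskian matrix of the `y_j(0)` has an inverse with entries in
`W_p^{n+1}`, built from the adjoint system, so coefficients `A` are bounded by the values of the
lower-order terms on the `y_j(0)` (`exists_norm_le_sum_norm_lowerTerms`). Comparing the equations at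
`ε` and `0` and absorbing the term containing `A(ε) - A(0)` gives (I). For (II), fix `x` and solve
`L(ε) z = L(ε) x`, `B(ε) z = B(0) x`. By (I) the data converge, so `z(ε) → x`. The difference `z(ε)
- x` lies in `ker L(ε)` and is the combination of the `y_j(ε)` whose coefficients are the
coordinates of `B(0)x - B(ε)x`. The `y_j(0)` are linearly independent, so these coefficients tend to
zero. -/

noncomputable section

/-! ### Primitives of integrable functions on a compact interval -/

/-- `u` is a primitive on `[a,b]` of the integrable function `v`. -/
def IsPrimitiveOn (a b : ℝ) (u v : ℝ → ℂ) : Prop :=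
  IntegrableOn v (Icc a b) ∧ ∀ t ∈ Icc a b, u t = u a + ∫ s in a..t, v s

theorem MeasureTheory.IntegrableOn.intervalIntegrable_of_mem_Icc {E : Type*}
    [NormedAddCommGroup E] {a b : ℝ} {v : ℝ → E} (hv : IntegrableOn v (Icc a b)) {s t : ℝ} (hs : s ∈ Icc a b) (ht : t ∈ Icc a b) :
    IntervalIntegrable v volume s t :=
  (hv.mono_set (uIcc_subset_Icc hs ht)).intervalIntegrable

namespace IsPrimitiveOn

variable {a b : ℝ} {u v u₁ u₂ v₁ v₂ : ℝ → ℂ}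

theorem sub_eq (h : IsPrimitiveOn a b u v) {s t : ℝ} (hs : s ∈ Icc a b) (ht : t ∈ Icc a b) :
    u t - u s = ∫ x in s..t, v x := by
  have ha : a ∈ Icc a b := ⟨le_rfl, hs.1.trans hs.2⟩
  rw [h.2 t ht, h.2 s hs, add_sub_add_left_eq_sub]
  exact intervalIntegral.integral_interval_sub_left
    (h.1.intervalIntegrable_of_mem_Icc ha ht) (h.1.intervalIntegrable_of_mem_Icc ha hs)

/-- The increments of `u` are dominated by those of the primitive of `‖v‖`, which is absolutely
continuous. -/
theorem absolutelyContinuous (h : IsPrimitiveOn a b u v) (hab : a ≤ b) :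
    AbsolutelyContinuousOnInterval u a b := by
  have ha : a ∈ Icc a b := ⟨le_rfl, hab⟩
  have hb : b ∈ Icc a b := ⟨hab, le_rfl⟩
  have hn : IntegrableOn (fun t => ‖v t‖) (Icc a b) := h.1.norm
  have h1 := (hn.intervalIntegrable_of_mem_Icc ha hb).absolutelyContinuousOnInterval_intervalIntegral
    (c := a) left_mem_uIcc
  unfold AbsolutelyContinuousOnInterval at h1 ⊢
  refine squeeze_zero' (Eventually.of_forall fun _ => Finset.sum_nonneg fun _ _ => dist_nonneg)
    ?_ h1
  rw [eventually_inf_principal]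
  filter_upwards with E hE
  refine Finset.sum_le_sum fun i hi => ?_
  have hmem := hE.1 i hi
  rw [uIcc_of_le hab] at hmem
  rw [dist_comm, dist_eq_norm, h.sub_eq hmem.1 hmem.2, dist_comm, dist_eq_norm,
    intervalIntegral.integral_interval_sub_left (hn.intervalIntegrable_of_mem_Icc ha hmem.2)
      (hn.intervalIntegrable_of_mem_Icc ha hmem.1)]
  exact intervalIntegral.norm_integral_le_abs_integral_norm

theorem ae_hasDerivAt (h : IsPrimitiveOn a b u v) (hab : a ≤ b) :
    ∀ᵐ t, t ∈ Ioo a b → HasDerivAt u (v t) t := by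
  have ha : a ∈ Icc a b := ⟨le_rfl, hab⟩
  have hb : b ∈ Icc a b := ⟨hab, le_rfl⟩
  filter_upwards [(h.1.intervalIntegrable_of_mem_Icc ha hb).ae_hasDerivAt_integral] with t ht htm
  have h1 := (ht (by rw [uIcc_of_le hab]; exact Ioo_subset_Icc_self htm) a
    left_mem_uIcc).const_add (u a)
  refine h1.congr_of_eventuallyEq ?_
  filter_upwards [Icc_mem_nhds htm.1 htm.2] with s hs using h.2 s hs

/-- Subtracting the integral of `v` leaves an absolutely continuous function with derivative zero
a.e., hence a constant. This reduces the product rule for primitives to the pointwise one. -/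
theorem of_absolutelyContinuous (hab : a ≤ b) (hu : AbsolutelyContinuousOnInterval u a b)
    (hv : IntegrableOn v (Icc a b)) (hd : ∀ᵐ t, t ∈ Ioo a b → HasDerivAt u (v t) t) :
    IsPrimitiveOn a b u v := by
  have ha : a ∈ Icc a b := ⟨le_rfl, hab⟩
  have hw : IsPrimitiveOn a b (fun t => ∫ s in a..t, v s) v := ⟨hv, fun t _ => by simp⟩
  have hac := hu.sub (hw.absolutelyContinuous hab)
  obtain ⟨C, hC⟩ := hac.const_of_ae_hasDerivAt_zero (by
    have hends : ∀ᵐ t : ℝ, t ≠ a ∧ t ≠ b := by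
      filter_upwards [(countable_singleton a).ae_notMem volume,
        (countable_singleton b).ae_notMem volume] with t h1 h2 using ⟨h1, h2⟩
    filter_upwards [hd, hw.ae_hasDerivAt hab, hends] with t h1 h2 h3 h4
    rw [uIcc_of_le hab] at h4
    have h5 : t ∈ Ioo a b := ⟨lt_of_le_of_ne h4.1 h3.1.symm, lt_of_le_of_ne h4.2 h3.2⟩
    simpa using (h1 h5).sub (h2 h5))
  rw [uIcc_of_le hab] at hC
  refine ⟨hv, fun t ht => ?_⟩
  have h1 := hC t ht
  have h2 := hC a ha
  simp only [Pi.sub_apply, intervalIntegral.integral_same, sub_zero] at h1 h2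
  rw [h2, ← h1]; ring

theorem continuousOn (h : IsPrimitiveOn a b u v) (hab : a ≤ b) : ContinuousOn u (Icc a b) := by
  simpa [uIcc_of_le hab] using (h.absolutelyContinuous hab).continuousOn

theorem mul (h₁ : IsPrimitiveOn a b u₁ v₁) (h₂ : IsPrimitiveOn a b u₂ v₂) (hab : a ≤ b) :
    IsPrimitiveOn a b (fun t => u₁ t * u₂ t) (fun t => v₁ t * u₂ t + u₁ t * v₂ t) := by
  refine of_absolutelyContinuous hab
    ((h₁.absolutelyContinuous hab).smul (h₂.absolutelyContinuous hab)) ?_ ?_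
  · exact (h₁.1.mul_continuousOn (h₂.continuousOn hab) isCompact_Icc).add
      (h₂.1.continuousOn_mul (h₁.continuousOn hab) isCompact_Icc)
  · filter_upwards [h₁.ae_hasDerivAt hab, h₂.ae_hasDerivAt hab] with t h3 h4 ht
    exact (h3 ht).mul (h4 ht)

theorem of_contDiff {φ : ℝ → ℝ} (hφ : ContDiff ℝ ∞ φ) :
    IsPrimitiveOn a b (fun t => (φ t : ℂ)) (fun t => ((deriv φ t : ℝ) : ℂ)) := by
  have hc : Continuous (deriv φ) := hφ.continuous_deriv (by simp)
  have hc' : Continuous (fun t => ((deriv φ t : ℝ) : ℂ)) := Complex.continuous_ofReal.comp hc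
  refine ⟨hc'.continuousOn.integrableOn_Icc, fun t _ => ?_⟩
  rw [intervalIntegral.integral_eq_sub_of_hasDerivAt
    (f := fun t => (φ t : ℂ)) (fun x _ => ?_) (hc'.intervalIntegrable _ _)]
  · ring
  · exact ((hφ.differentiable (by simp)) x).hasDerivAt.ofReal_comp

/-- The product rule for `φ u`, integrated over the whole interval; the boundary terms vanish with
`φ`. -/
theorem hasWeakDeriv (h : IsPrimitiveOn a b u v) (hab : a ≤ b) : HasWeakDeriv a b 1 u v := by
  intro φ h1 h2 h3
  have hm := (of_contDiff (a := a) (b := b) h1).mul h hab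
  have hb := hm.2 b ⟨hab, le_rfl⟩
  have hz : ∀ t, t ∉ Ioo a b → φ t = 0 := fun t ht =>
    image_eq_zero_of_notMem_tsupport fun h => ht (h3 h)
  have hc : Continuous (fun t => ((deriv φ t : ℝ) : ℂ)) :=
    Complex.continuous_ofReal.comp (h1.continuous_deriv (by simp))
  have hc' : Continuous (fun t => ((φ t : ℝ) : ℂ)) := Complex.continuous_ofReal.comp h1.continuous
  simp only [hz b (by simp), hz a (by simp)] at hb
  rw [intervalIntegral.integral_of_le hab,
    ← integral_Icc_eq_integral_Ioc, integral_add] at hb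
  · simp only [Complex.ofReal_zero, zero_mul, zero_add] at hb
    simp only [iteratedDeriv_one, Complex.real_smul, pow_one]
    rw [eq_comm, ← eq_neg_iff_add_eq_zero] at hb
    rw [hb]; ring
  · exact ((h.continuousOn hab).integrableOn_Icc).continuousOn_mul hc.continuousOn isCompact_Icc
  · exact h.1.continuousOn_mul hc'.continuousOn isCompact_Icc

end IsPrimitiveOn

/-- A test function on `(a,b)` with vanishing integral is the derivative of a test function. -/
theorem exists_testFunction_deriv_eq {a b : ℝ} (hab : a < b) {θ : ℝ → ℝ} (h1 : ContDiff ℝ ∞ θ)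
    (h2 : HasCompactSupport θ) (h3 : tsupport θ ⊆ Ioo a b) (h0 : ∫ t in a..b, θ t = 0) :
    ∃ Θ : ℝ → ℝ, ContDiff ℝ ∞ Θ ∧ HasCompactSupport Θ ∧ tsupport Θ ⊆ Ioo a b ∧ deriv Θ = θ := by
  have hd : ∀ t, HasDerivAt (fun t => ∫ s in a..t, θ s) (θ t) t := fun t =>
    intervalIntegral.integral_hasDerivAt_right (h1.continuous.intervalIntegrable _ _)
      h1.continuous.stronglyMeasurable.stronglyMeasurableAtFilter h1.continuous.continuousAt
  have hderiv : deriv (fun t => ∫ s in a..t, θ s) = θ := funext fun t => (hd t).deriv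
  -- The primitive vanishes to the left of `α` trivially and to the right of `β` because the total
  -- integral is zero. An empty support has no extreme points and is treated apart.
  obtain ⟨α, β, hα, hαβ, hβ, hsub⟩ :
      ∃ α β, a < α ∧ α ≤ β ∧ β < b ∧ tsupport θ ⊆ Icc α β := by
    rcases (tsupport θ).eq_empty_or_nonempty with he | hne
    · obtain ⟨c, hc⟩ := exists_between hab
      exact ⟨c, c, hc.1, le_rfl, hc.2, by simp [he]⟩
    · have hK : IsCompact (tsupport θ) := h2
      have hi := hK.sInf_mem hne
      have hs := hK.sSup_mem hne
      exact ⟨_, _, (h3 hi).1, csInf_le hK.bddBelow hs, (h3 hs).2,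
        fun t ht => ⟨csInf_le hK.bddBelow ht, le_csSup hK.bddAbove ht⟩⟩
  have hz : ∀ t, t ∉ Icc α β → θ t = 0 := fun t ht =>
    image_eq_zero_of_notMem_tsupport fun h => ht (hsub h)
  have hsupp : tsupport (fun t => ∫ s in a..t, θ s) ⊆ Icc α β := by
    refine closure_minimal (fun t ht => ?_) isClosed_Icc
    by_contra hn
    refine ht ?_
    rcases lt_or_ge t α with h | h
    · refine (intervalIntegral.integral_congr (g := fun _ => 0) fun s hs => ?_).trans (by simp)
      refine hz s fun hs' => ?_
      rcases mem_uIcc.1 hs with h5 | h5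
      · exact absurd (hs'.1.trans h5.2) (not_le.2 h)
      · exact absurd (hs'.1.trans h5.2) (not_le.2 hα)
    · have h' : β < t := lt_of_not_ge fun h' => hn ⟨h, h'⟩
      have h5 : ∫ s in b..t, θ s = 0 := by
        refine (intervalIntegral.integral_congr (g := fun _ => 0) fun s hs => ?_).trans (by simp)
        refine hz s fun hs' => ?_
        rcases mem_uIcc.1 hs with h5 | h5
        · exact absurd (h5.1.trans hs'.2) (not_le.2 hβ)
        · exact absurd (h5.1.trans hs'.2) (not_le.2 h')
      have h6 := intervalIntegral.integral_add_adjacent_intervals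
        (h1.continuous.intervalIntegrable (μ := volume) a b) (h1.continuous.intervalIntegrable b t)
      simp only [h0, h5, add_zero] at h6
      exact h6.symm
  refine ⟨fun t => ∫ s in a..t, θ s, ?_, ?_, ?_, hderiv⟩
  · rw [contDiff_infty_iff_deriv, hderiv]
    exact ⟨fun t => (hd t).differentiableAt, h1⟩
  · exact isCompact_Icc.of_isClosed_subset (isClosed_tsupport _) hsupp
  · exact hsupp.trans fun t ht => ⟨hα.trans_le ht.1, ht.2.trans_lt hβ⟩

/-- The lemma of du Bois-Reymond: a function with vanishing weak derivative is constant. -/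
theorem HasWeakDeriv.exists_ae_eq_const {a b : ℝ} (hab : a < b) {w : ℝ → ℂ}
    (hw : IntegrableOn w (Icc a b)) (h : HasWeakDeriv a b 1 w 0) :
    ∃ c : ℂ, ∀ᵐ t ∂(volume.restrict (Icc a b)), w t = c := by
  obtain ⟨x, hx⟩ := exists_between hab
  obtain ⟨ψ, hψ3, hψ2, hψ1, hψr, hψx⟩ :=
    exists_contDiff_tsupport_subset (n := ⊤) (Ioo_mem_nhds hx.1 hx.2)
  have hJ : 0 < ∫ t in a..b, ψ t := by
    rw [intervalIntegral.integral_of_le hab.le, ← integral_Icc_eq_integral_Ioc,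
      setIntegral_eq_integral_of_forall_compl_eq_zero]
    · exact hψ1.continuous.integral_pos_of_hasCompactSupport_nonneg_nonzero hψ2
        (fun t => (hψr (mem_range_self t)).1) (x := x) (by simp [hψx])
    · exact fun t ht => image_eq_zero_of_notMem_tsupport fun h => ht (Ioo_subset_Icc_self (hψ3 h))
  set J := ∫ t in a..b, ψ t with hJdef
  have hint : ∀ {g : ℝ → ℝ}, Continuous g → Integrable (fun t => g t • w t)
      (volume.restrict (Icc a b)) := fun hg => hw.continuousOn_smul hg.continuousOn isCompact_Icc
  set c : ℂ := (J : ℂ)⁻¹ * ∫ t in Icc a b, ψ t • w t with hc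
  refine ⟨c, ?_⟩
  have hz : ∀ᵐ t ∂(volume : Measure ℝ), t ∈ Ioo a b → w t - c = 0 := by
    refine isOpen_Ioo.ae_eq_zero_of_integral_contDiff_smul_eq_zero (f := fun t => w t - c) ?_ ?_
    · exact ((hw.sub (integrableOn_const (by simp))).mono_set
        Ioo_subset_Icc_self).locallyIntegrableOn
    · intro φ h1 h2 h3
      set I := ∫ t in a..b, φ t with hI
      -- Subtracting a multiple of the bump `ψ` makes the integral of `φ` zero, so the result is
      -- some `Θ'`. Testing `h` on `Θ` gives `∫ φ w = (I / J) ∫ ψ w = I c`, so `c` is the mean of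
      -- `w` with weight `ψ / J`.
      obtain ⟨Θ, hΘ1, hΘ2, hΘ3, hΘ⟩ := exists_testFunction_deriv_eq hab
        (θ := fun t => φ t - I / J * ψ t) (h1.sub (contDiff_const.mul hψ1)) (h2.sub hψ2.mul_left)
        ((tsupport_sub _ _).trans
          (union_subset h3 ((tsupport_mul_subset_right).trans hψ3))) (by
          have hmc : Continuous fun t => I / J * ψ t := continuous_const.mul hψ1.continuous
          rw [intervalIntegral.integral_sub (h1.continuous.intervalIntegrable _ _)
            (hmc.intervalIntegrable _ _), intervalIntegral.integral_const_mul, ← hJdef, ← hI]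
          field_simp; ring)
      have h4 := h Θ hΘ1 hΘ2 hΘ3
      simp only [iteratedDeriv_one, hΘ, Pi.zero_apply, smul_zero, integral_zero, mul_zero,
        sub_smul, mul_smul] at h4
      have hsm : Integrable (fun t => (I / J) • ψ t • w t) (volume.restrict (Icc a b)) :=
        (hint hψ1.continuous).smul (I / J)
      rw [integral_sub (hint h1.continuous) hsm,
        integral_smul, sub_eq_zero] at h4
      have hsupp : ∀ t, t ∉ Icc a b → φ t • (w t - c) = 0 := by
        intro t ht
        have : t ∉ tsupport φ := fun h => ht (Ioo_subset_Icc_self (h3 h))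
        rw [image_eq_zero_of_notMem_tsupport this, zero_smul]
      rw [← setIntegral_eq_integral_of_forall_compl_eq_zero hsupp]
      simp_rw [smul_sub]
      rw [integral_sub (hint h1.continuous)
        (h1.continuous.continuousOn.integrableOn_Icc.smul_const c), h4, integral_smul_const,
        integral_Icc_eq_integral_Ioc (f := φ), ← intervalIntegral.integral_of_le hab.le, ← hI, hc]
      have hJ' : (J : ℂ) ≠ 0 := by exact_mod_cast hJ.ne'
      simp only [Complex.real_smul]
      push_cast
      field_simp
      ring
  have hIoo : ∀ᵐ t ∂(volume.restrict (Icc a b)), t ∈ Ioo a b := by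
    rw [← restrict_Ioo_eq_restrict_Icc]
    exact ae_restrict_mem measurableSet_Ioo
  filter_upwards [ae_restrict_of_ae hz, hIoo] with t ht htm using sub_eq_zero.1 (ht htm)

/-- A function with an integrable weak derivative is a.e. equal to a primitive of it. -/
theorem HasWeakDeriv.exists_isPrimitiveOn {a b : ℝ} (hab : a < b) {u v : ℝ → ℂ}
    (hu : IntegrableOn u (Icc a b)) (hv : IntegrableOn v (Icc a b)) (h : HasWeakDeriv a b 1 u v) :
    ∃ c : ℂ, ∀ᵐ t ∂(volume.restrict (Icc a b)), u t = c + ∫ s in a..t, v s := by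
  have hp : IsPrimitiveOn a b (fun t => ∫ s in a..t, v s) v := ⟨hv, fun t _ => by simp⟩
  have hpi : IntegrableOn (fun t => ∫ s in a..t, v s) (Icc a b) :=
    (hp.continuousOn hab.le).integrableOn_Icc
  obtain ⟨c, hc⟩ := HasWeakDeriv.exists_ae_eq_const hab (hu.sub hpi) (by
    intro φ h1 h2 h3
    have hg : Continuous (iteratedDeriv 1 φ) := continuous_iteratedDeriv_test h1 1
    simp only [Pi.sub_apply, smul_sub, Pi.zero_apply, smul_zero, integral_zero, mul_zero]
    rw [integral_sub (hu.continuousOn_smul hg.continuousOn isCompact_Icc)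
      (hpi.continuousOn_smul hg.continuousOn isCompact_Icc), h φ h1 h2 h3,
      hp.hasWeakDeriv hab.le φ h1 h2 h3, sub_self])
  refine ⟨c, ?_⟩
  filter_upwards [hc] with t ht
  rw [← ht, Pi.sub_apply, sub_add_cancel]

/-! ### Sobolev spaces: norms, derivatives, completeness -/

theorem HasWeakDeriv.congr_ae {a b : ℝ} {k : ℕ} {u v u' v' : ℝ → ℂ} (h : HasWeakDeriv a b k u v)
    (hu : u =ᵐ[volume.restrict (Icc a b)] u') (hv : v =ᵐ[volume.restrict (Icc a b)] v') :
    HasWeakDeriv a b k u' v' := by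
  intro φ h1 h2 h3
  have e1 : ∫ t in Icc a b, iteratedDeriv k φ t • u' t =
      ∫ t in Icc a b, iteratedDeriv k φ t • u t := by
    refine integral_congr_ae ?_
    filter_upwards [hu] with t ht using by rw [ht]
  have e2 : ∫ t in Icc a b, φ t • v' t = ∫ t in Icc a b, φ t • v t := by
    refine integral_congr_ae ?_
    filter_upwards [hv] with t ht using by rw [ht]
  rw [e1, e2, h φ h1 h2 h3]

theorem iteratedDeriv_add_eq (k l : ℕ) (φ : ℝ → ℝ) :
    iteratedDeriv (k + l) φ = iteratedDeriv k (iteratedDeriv l φ) := by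
  simp only [iteratedDeriv_eq_iterate, Function.iterate_add_apply]

theorem tsupport_iteratedDeriv_subset (k : ℕ) (φ : ℝ → ℝ) :
    tsupport (iteratedDeriv k φ) ⊆ tsupport φ := by
  induction k with
  | zero => simp
  | succ k ih => rw [iteratedDeriv_succ]; exact (tsupport_deriv_subset).trans ih

theorem HasWeakDeriv.integral_iteratedDeriv {a b : ℝ} {k : ℕ} {u v : ℝ → ℂ}
    (h : HasWeakDeriv a b k u v) (l : ℕ) {φ : ℝ → ℝ} (h1 : ContDiff ℝ ∞ φ)
    (h2 : HasCompactSupport φ) (h3 : tsupport φ ⊆ Ioo a b) :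
    ∫ t in Icc a b, iteratedDeriv (k + l) φ t • u t =
      (-1) ^ k * ∫ t in Icc a b, iteratedDeriv l φ t • v t := by
  rw [iteratedDeriv_add_eq]
  refine h _ ?_ ?_ ((tsupport_iteratedDeriv_subset l φ).trans h3)
  · rw [iteratedDeriv_eq_iterate]
    exact ContDiff.iterate_deriv l h1
  · exact h2.of_isClosed_subset (isClosed_tsupport _) (tsupport_iteratedDeriv_subset l φ)

theorem HasWeakDeriv.trans {a b : ℝ} {k l : ℕ} {u v w : ℝ → ℂ}
    (h : HasWeakDeriv a b k u v) (h' : HasWeakDeriv a b l v w) : HasWeakDeriv a b (k + l) u w := by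
  intro φ h1 h2 h3
  rw [h.integral_iteratedDeriv l h1 h2 h3, h' φ h1 h2 h3, pow_add, mul_assoc]

/-- The derivatives of a derivative are the higher derivatives of the original function; this is why
`derivTo` lands in a Sobolev space. -/
theorem HasWeakDeriv.of_add {a b : ℝ} {k l : ℕ} {u v w : ℝ → ℂ}
    (h : HasWeakDeriv a b k u v) (h' : HasWeakDeriv a b (k + l) u w) : HasWeakDeriv a b l v w := by
  intro φ h1 h2 h3
  have h4 := h' φ h1 h2 h3
  rw [h.integral_iteratedDeriv l h1 h2 h3, pow_add, mul_assoc] at h4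
  exact mul_left_cancel₀ (pow_ne_zero _ (by norm_num)) h4

theorem LpI.integrableOn {a b : ℝ} {p : ℝ≥0∞} [hp : Fact (1 ≤ p)] (u : LpI a b p) :
    IntegrableOn (u : ℝ → ℂ) (Icc a b) :=
  (Lp.memLp u).integrable hp.out

/-- Hölder's inequality on a set of finite measure. The sup-norm bounds on primitives below rest on
this embedding into `L_1`. -/
theorem LpI.exists_integral_norm_le (a b : ℝ) (p : ℝ≥0∞) [hp : Fact (1 ≤ p)] :
    ∃ C : ℝ, 0 ≤ C ∧ ∀ u : LpI a b p, ∫ t in Icc a b, ‖u t‖ ≤ C * ‖u‖ := by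
  refine ⟨((volume.restrict (Icc a b)) univ ^ (1 / (1 : ℝ≥0∞).toReal - 1 / p.toReal)).toReal,
    ENNReal.toReal_nonneg, fun u => ?_⟩
  have h1 := eLpNorm_le_eLpNorm_mul_rpow_measure_univ hp.out (Lp.aestronglyMeasurable u)
  rw [Lp.norm_def, mul_comm, ← ENNReal.toReal_mul,
    integral_norm_eq_lintegral_enorm (Lp.aestronglyMeasurable u), ← eLpNorm_one_eq_lintegral_enorm]
  refine ENNReal.toReal_mono (ENNReal.mul_ne_top (Lp.eLpNorm_ne_top u) ?_) h1
  refine ENNReal.rpow_ne_top_of_nonneg ?_ (by simp)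
  rcases eq_or_ne p ⊤ with rfl | hpt
  · simp
  · have : 1 ≤ p.toReal := by simpa using ENNReal.toReal_mono hpt hp.out
    simpa using inv_le_one_of_one_le₀ this

/-- The functional `u ↦ ∫ g u` on `L_p([a,b], ℂ)`, where `g` is continuous. -/
def LpI.pairing {a b : ℝ} {p : ℝ≥0∞} [Fact (1 ≤ p)] (g : ℝ → ℝ) (hg : Continuous g) :
    LpI a b p →ₗ[ℂ] ℂ where
  toFun u := ∫ t in Icc a b, g t • u t
  map_add' u v := by
    rw [← integral_add (integrable_smul_Lp hg u) (integrable_smul_Lp hg v)]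
    refine integral_congr_ae ?_
    filter_upwards [Lp.coeFn_add u v] with t ht
    rw [ht, Pi.add_apply, smul_add]
  map_smul' c u := by
    rw [RingHom.id_apply, smul_eq_mul, ← integral_const_mul]
    refine integral_congr_ae ?_
    filter_upwards [Lp.coeFn_smul c u] with t ht
    rw [ht, Pi.smul_apply, smul_eq_mul, mul_smul_comm]

theorem LpI.continuous_pairing {a b : ℝ} {p : ℝ≥0∞} [Fact (1 ≤ p)] (g : ℝ → ℝ)
    (hg : Continuous g) : Continuous (LpI.pairing g hg : LpI a b p →ₗ[ℂ] ℂ) := by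
  obtain ⟨C, hC0, hC⟩ := LpI.exists_integral_norm_le a b p
  obtain ⟨M, hM⟩ := (isCompact_Icc (a := a) (b := b)).exists_bound_of_continuousOn hg.continuousOn
  refine AddMonoidHomClass.continuous_of_bound (LpI.pairing g hg) (|M| * C) fun u => ?_
  change ‖∫ t in Icc a b, g t • u t‖ ≤ _
  calc ‖∫ t in Icc a b, g t • u t‖ ≤ ∫ t in Icc a b, |M| * ‖u t‖ := by
        refine norm_integral_le_of_norm_le ((LpI.integrableOn u).norm.const_mul _) ?_
        filter_upwards [ae_restrict_mem measurableSet_Icc] with t ht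
        rw [norm_smul]
        gcongr
        exact (hM t ht).trans (le_abs_self M)
    _ ≤ |M| * C * ‖u‖ := by
        rw [integral_const_mul, mul_assoc]
        gcongr
        exact hC u

namespace Sobolev

variable {a b : ℝ} {n : ℕ} {p : ℝ≥0∞} [Fact (1 ≤ p)]

theorem norm_weakDeriv_le (k : Fin (n + 1)) (u : Sobolev a b n p) : ‖weakDeriv k u‖ ≤ ‖u‖ :=
  PiLp.norm_apply_le (jet u) k

theorem norm_le_sum_norm_weakDeriv (u : Sobolev a b n p) : ‖u‖ ≤ ∑ k, ‖weakDeriv k u‖ := by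
  have h : jet u =
      ∑ k, PiLp.single (β := fun _ : Fin (n + 1) => LpI a b p) p k (weakDeriv k u) := by
    ext1 i
    rw [WithLp.ofLp_sum, Finset.sum_apply, Finset.sum_eq_single i]
    · symm; apply PiLp.single_eq_same
    · intro j _ hj; apply PiLp.single_eq_of_ne; exact hj.symm
    · simp
  calc ‖u‖ = ‖jet u‖ := rfl
    _ ≤ ∑ k, ‖(PiLp.single p k (weakDeriv k u) : PiLp p fun _ : Fin (n + 1) => LpI a b p)‖ := by
        rw [h]; exact norm_sum_le _ _
    _ = _ := by simp only [PiLp.norm_single]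

/-- The jets are cut out by the equations defining weak derivatives, one for each test function and
order, and both sides are continuous on `L_p`. Completeness of the Sobolev space follows, which open
mapping and Banach–Steinhaus need later. -/
theorem isClosed_range_jet :
    IsClosed (range (jet : Sobolev a b n p → PiLp p (fun _ : Fin (n + 1) => LpI a b p))) := by
  have h : range (jet : Sobolev a b n p → PiLp p (fun _ : Fin (n + 1) => LpI a b p)) =
      {w | ∀ k : Fin (n + 1), HasWeakDeriv a b k (w 0) (w k)} := by
    ext w
    constructor
    · rintro ⟨u, rfl⟩ k
      have := hasWeakDeriv_weakDeriv k u
      rwa [← weakDeriv_zero] at this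
    · intro hw
      let u : Sobolev a b n p :=
        (⟨w 0, fun k hk => ⟨w ⟨k, by omega⟩, hw ⟨k, by omega⟩⟩⟩ : sobolevSubmodule a b n p)
      refine ⟨u, ?_⟩
      ext1 k
      exact (hasWeakDeriv_weakDeriv k u).unique (hw k)
  rw [h]
  have h' : {w : PiLp p (fun _ : Fin (n + 1) => LpI a b p) |
        ∀ k : Fin (n + 1), HasWeakDeriv a b k (w 0) (w k)} =
      ⋂ (k : Fin (n + 1)) (φ : ℝ → ℝ) (h1 : ContDiff ℝ ∞ φ) (_ : HasCompactSupport φ)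
        (_ : tsupport φ ⊆ Ioo a b),
        {w | LpI.pairing (iteratedDeriv k φ) (continuous_iteratedDeriv_test h1 k) (w 0) =
          (-1) ^ (k : ℕ) * LpI.pairing φ h1.continuous (w k)} := by
    ext w
    simp only [mem_iInter]
    rfl
  rw [h']
  refine isClosed_iInter fun k => isClosed_iInter fun φ => isClosed_iInter fun h1 =>
    isClosed_iInter fun _ => isClosed_iInter fun _ => isClosed_eq ?_ ?_
  · exact (LpI.continuous_pairing _ _).comp (PiLp.continuous_apply p _ _)
  · exact continuous_const.mul ((LpI.continuous_pairing _ _).comp (PiLp.continuous_apply p _ _))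

instance instCompleteSpace : CompleteSpace (Sobolev a b n p) := by
  have hi : Isometry (jet : Sobolev a b n p → PiLp p (fun _ : Fin (n + 1) => LpI a b p)) :=
    AddMonoidHomClass.isometry_of_norm _ fun _ => rfl
  rw [completeSpace_iff_isComplete_range hi.isUniformInducing]
  exact isClosed_range_jet.isComplete

/-- The derivative of order `k`, with values in the Sobolev space of order `l`. -/
def derivTo (k l : ℕ) (h : k + l ≤ n) : Sobolev a b n p →L[ℂ] Sobolev a b l p :=
  LinearMap.mkContinuous
    { toFun := fun u => (⟨weakDeriv ⟨k, by omega⟩ u, fun j hj =>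
        ⟨weakDeriv ⟨k + j, by omega⟩ u, (hasWeakDeriv_weakDeriv ⟨k, by omega⟩ u).of_add
          (hasWeakDeriv_weakDeriv ⟨k + j, by omega⟩ u)⟩⟩ : sobolevSubmodule a b l p)
      map_add' := fun u v => Subtype.ext ((weakDeriv ⟨k, by omega⟩).map_add u v)
      map_smul' := fun c u => Subtype.ext ((weakDeriv ⟨k, by omega⟩).map_smul c u) }
    (∑ _ : Fin (l + 1), 1) fun u => by
      refine (norm_le_sum_norm_weakDeriv _).trans ?_
      rw [Finset.sum_mul]
      refine Finset.sum_le_sum fun j _ => ?_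
      rw [one_mul]
      refine le_trans (le_of_eq (congrArg norm ?_)) (norm_weakDeriv_le ⟨k + j, by omega⟩ u)
      refine (hasWeakDeriv_weakDeriv j _).unique ?_
      exact (hasWeakDeriv_weakDeriv ⟨k, by omega⟩ u).of_add
          (hasWeakDeriv_weakDeriv ⟨k + j, by omega⟩ u)

theorem toLp_derivTo {k l : ℕ} (h : k + l ≤ n) (u : Sobolev a b n p) :
    toLp (derivTo k l h u) = weakDeriv ⟨k, by omega⟩ u := rfl

theorem weakDeriv_derivTo {k l : ℕ} (h : k + l ≤ n) (j : Fin (l + 1)) (u : Sobolev a b n p) :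
    weakDeriv j (derivTo k l h u) = weakDeriv ⟨k + j, by omega⟩ u :=
  (hasWeakDeriv_weakDeriv j _).unique ((hasWeakDeriv_weakDeriv ⟨k, by omega⟩ u).of_add
    (hasWeakDeriv_weakDeriv ⟨k + j, by omega⟩ u))

theorem derivTo_derivTo {k l i j : ℕ} (h : k + l ≤ n) (h' : i + j ≤ l) (u : Sobolev a b n p) :
    derivTo i j h' (derivTo k l h u) = derivTo (k + i) j (by omega) u :=
  toLp_injective (weakDeriv_derivTo h ⟨i, by omega⟩ u)

theorem toLp_derivTo_zero {l : ℕ} (h : 0 + l ≤ n) (u : Sobolev a b n p) :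
    toLp (derivTo 0 l h u) = toLp u := weakDeriv_zero u

theorem weakDeriv_eq_of_hasWeakDeriv {u : Sobolev a b n p} {k : Fin (n + 1)} {v : LpI a b p}
    (h : HasWeakDeriv a b k (toLp u) v) : weakDeriv k u = v :=
  (hasWeakDeriv_weakDeriv k u).unique h

end Sobolev

/-! ### Integration and continuous representatives -/

namespace Sobolev

theorem memLp_of_continuousOn {a b : ℝ} {p : ℝ≥0∞} {f : ℝ → ℂ} (hf : ContinuousOn f (Icc a b)) :
    MemLp f p (volume.restrict (Icc a b)) := by
  obtain ⟨M, hM⟩ := isCompact_Icc.exists_bound_of_continuousOn hf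
  refine MemLp.of_bound (hf.aestronglyMeasurable measurableSet_Icc) M ?_
  filter_upwards [ae_restrict_mem measurableSet_Icc] with t ht using hM t ht

theorem intervalIntegral_congr_Lp {a b : ℝ} {u v : ℝ → ℂ} (h : u =ᵐ[volume.restrict (Icc a b)] v)
    {t : ℝ} (ht : t ∈ Icc a b) : ∫ s in a..t, u s = ∫ s in a..t, v s := by
  refine intervalIntegral.integral_congr_ae ?_
  filter_upwards [(ae_restrict_iff' measurableSet_Icc).1 h] with s hs hst
  rw [uIoc_of_le ht.1] at hst
  exact hs ⟨hst.1.le, hst.2.trans ht.2⟩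

variable {a b : ℝ} {n : ℕ} {p : ℝ≥0∞} [Fact (1 ≤ p)]

theorem isPrimitiveOn_integral (c : ℂ) (v : LpI a b p) :
    IsPrimitiveOn a b (fun t => c + ∫ s in a..t, v s) v :=
  ⟨v.integrableOn, fun t _ => by simp⟩

variable [hab : Fact (a < b)]

/-- The primitive of `v` with value `c` at `a`, as an element of `L_p`. -/
def primLp (v : LpI a b p) (c : ℂ) : LpI a b p :=
  (memLp_of_continuousOn ((isPrimitiveOn_integral c v).continuousOn hab.out.le)).toLp _

theorem coeFn_primLp (v : LpI a b p) (c : ℂ) :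
    primLp v c =ᵐ[volume.restrict (Icc a b)] fun t => c + ∫ s in a..t, v s :=
  MemLp.coeFn_toLp _

theorem hasWeakDeriv_primLp (v : LpI a b p) (c : ℂ) : HasWeakDeriv a b 1 (primLp v c) v :=
  ((isPrimitiveOn_integral c v).hasWeakDeriv hab.out.le).congr_ae (coeFn_primLp v c).symm
    (ae_eq_refl _)

theorem primLp_add (v₁ v₂ : LpI a b p) (c₁ c₂ : ℂ) :
    primLp (v₁ + v₂) (c₁ + c₂) = primLp v₁ c₁ + primLp v₂ c₂ := by
  refine Lp.ext ?_
  filter_upwards [coeFn_primLp (v₁ + v₂) (c₁ + c₂), coeFn_primLp v₁ c₁, coeFn_primLp v₂ c₂,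
    Lp.coeFn_add (primLp v₁ c₁) (primLp v₂ c₂), ae_restrict_mem measurableSet_Icc]
    with t h h1 h2 h3 ht
  have ha : a ∈ Icc a b := ⟨le_rfl, hab.out.le⟩
  rw [h, h3, Pi.add_apply, h1, h2, intervalIntegral_congr_Lp (Lp.coeFn_add v₁ v₂) ht]
  simp only [Pi.add_apply]
  rw [intervalIntegral.integral_add (v₁.integrableOn.intervalIntegrable_of_mem_Icc ha ht)
    (v₂.integrableOn.intervalIntegrable_of_mem_Icc ha ht)]
  ring

theorem primLp_smul (z : ℂ) (v : LpI a b p) (c : ℂ) :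
    primLp (z • v) (z • c) = z • primLp v c := by
  refine Lp.ext ?_
  filter_upwards [coeFn_primLp (z • v) (z • c), coeFn_primLp v c,
    Lp.coeFn_smul z (primLp v c), ae_restrict_mem measurableSet_Icc] with t h h1 h3 ht
  rw [h, h3, Pi.smul_apply, h1, intervalIntegral_congr_Lp (Lp.coeFn_smul z v) ht]
  simp only [Pi.smul_apply]
  rw [intervalIntegral.integral_smul, smul_add]

/-- The primitive of `v` with value `c` at `a`. -/
def integ : (Sobolev a b n p × ℂ) →ₗ[ℂ] Sobolev a b (n + 1) p where
  toFun w := (⟨primLp (toLp w.1) w.2, fun k hk => by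
    rcases k with _ | k
    · exact ⟨_, hasWeakDeriv_zero_self _⟩
    · refine ⟨weakDeriv ⟨k, by omega⟩ w.1, ?_⟩
      rw [add_comm]
      exact (hasWeakDeriv_primLp _ _).trans
        (hasWeakDeriv_weakDeriv (⟨k, by omega⟩ : Fin (n + 1)) w.1)⟩ :
    sobolevSubmodule a b (n + 1) p)
  map_add' w₁ w₂ := Subtype.ext (primLp_add _ _ _ _)
  map_smul' z w := Subtype.ext (primLp_smul _ _ _)

theorem toLp_integ (w : Sobolev a b n p × ℂ) : toLp (integ w) = primLp (toLp w.1) w.2 := rfl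

theorem derivTo_integ (w : Sobolev a b n p × ℂ) :
    derivTo 1 n (by omega) (integ w) = w.1 :=
  toLp_injective (weakDeriv_eq_of_hasWeakDeriv (hasWeakDeriv_primLp _ _))

theorem weakDeriv_integ_succ (w : Sobolev a b n p × ℂ) (k : Fin (n + 1)) :
    weakDeriv k.succ (integ w) = weakDeriv k w.1 := by
  have h := weakDeriv_derivTo (n := n + 1) (k := 1) (by omega) k (integ w)
  rw [derivTo_integ] at h
  have hk : k.succ = ⟨1 + k, by omega⟩ := Fin.ext (add_comm _ _)
  rw [h, hk]

theorem eq_of_ae_eq_const {c d : ℂ} (h : ∀ᵐ _t ∂(volume.restrict (Icc a b)), c = d) : c = d := by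
  have : NeZero (volume.restrict (Icc a b)) := ⟨by
    rw [Ne, Measure.restrict_eq_zero]
    simp [hab.out]⟩
  exact h.exists.choose_spec

/-- Differentiation recovers the first component, and two constants that agree a.e. on a non-null
interval are equal. Surjectivity is the representation of a function as a primitive of its weak
derivative. -/
theorem bijective_integ :
    Function.Bijective (integ : (Sobolev a b n p × ℂ) →ₗ[ℂ] Sobolev a b (n + 1) p) := by
  constructor
  · intro w₁ w₂ h
    have h1 : w₁.1 = w₂.1 := by rw [← derivTo_integ w₁, h, derivTo_integ]
    refine Prod.ext h1 (eq_of_ae_eq_const (a := a) (b := b) ?_)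
    have h2 : primLp (toLp w₁.1) w₁.2 = primLp (toLp w₁.1) w₂.2 := by
      have := congrArg toLp h
      rwa [toLp_integ, toLp_integ, ← h1] at this
    filter_upwards [coeFn_primLp (toLp w₁.1) w₁.2, coeFn_primLp (toLp w₁.1) w₂.2] with t h3 h4
    rw [h2, h4] at h3
    simpa using h3.symm
  · intro u
    have hd : HasWeakDeriv a b 1 (toLp u) (weakDeriv ⟨1, by omega⟩ u) :=
      hasWeakDeriv_weakDeriv ⟨1, by omega⟩ u
    obtain ⟨c, hc⟩ := hd.exists_isPrimitiveOn hab.out (LpI.integrableOn _) (LpI.integrableOn _)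
    refine ⟨(derivTo 1 n (by omega) u, c), toLp_injective (Lp.ext ?_)⟩
    filter_upwards [hc, coeFn_primLp (weakDeriv ⟨1, by omega⟩ u) c] with t h1 h2
    rw [h1, toLp_integ, ← h2]
    rfl

theorem exists_norm_primLp_le :
    ∃ C : ℝ, ∀ (v : LpI a b p) (c : ℂ), ‖primLp v c‖ ≤ C * (‖v‖ + ‖c‖) := by
  obtain ⟨C, hC0, hC⟩ := LpI.exists_integral_norm_le a b p
  refine ⟨(measureUnivNNReal (volume.restrict (Icc a b)) : ℝ) ^ p.toReal⁻¹ * (C + 1), fun v c => ?_⟩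
  have hb : ∀ᵐ t ∂(volume.restrict (Icc a b)), ‖primLp v c t‖ ≤ (C + 1) * (‖v‖ + ‖c‖) := by
    filter_upwards [coeFn_primLp v c, ae_restrict_mem measurableSet_Icc] with t h ht
    rw [h]
    have h1 : ‖∫ s in a..t, v s‖ ≤ C * ‖v‖ := by
      rw [intervalIntegral.integral_of_le ht.1]
      refine (norm_integral_le_integral_norm _).trans (le_trans ?_ (hC v))
      refine setIntegral_mono_set v.integrableOn.norm (Eventually.of_forall fun _ => norm_nonneg _)
        (LE.le.eventuallyLE fun s hs => ⟨hs.1.le, hs.2.trans ht.2⟩)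
    calc ‖c + ∫ s in a..t, v s‖ ≤ ‖c‖ + C * ‖v‖ := (norm_add_le _ _).trans (by gcongr)
      _ ≤ (C + 1) * (‖v‖ + ‖c‖) := by nlinarith [norm_nonneg v, norm_nonneg c]
  have h := Lp.norm_le_of_ae_bound (by positivity) hb
  rwa [← mul_assoc] at h

theorem continuous_integ :
    Continuous (integ : (Sobolev a b n p × ℂ) →ₗ[ℂ] Sobolev a b (n + 1) p) := by
  obtain ⟨C, hC⟩ := exists_norm_primLp_le (a := a) (b := b) (p := p)
  refine AddMonoidHomClass.continuous_of_bound integ (|C| * 2 + (n + 1)) fun w => ?_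
  refine (norm_le_sum_norm_weakDeriv _).trans ?_
  rw [Fin.sum_univ_succ, weakDeriv_zero, toLp_integ, add_mul]
  have h1 : ‖w.1‖ ≤ ‖w‖ := norm_fst_le w
  have h2 : ‖w.2‖ ≤ ‖w‖ := norm_snd_le w
  have h3 : ‖toLp w.1‖ ≤ ‖w.1‖ := by rw [← weakDeriv_zero]; exact norm_weakDeriv_le _ _
  refine add_le_add ?_ ?_
  · refine (hC _ _).trans ?_
    rw [mul_assoc]
    exact mul_le_mul (le_abs_self C) (by linarith) (by positivity) (abs_nonneg C)
  · calc _ ≤ ∑ _k : Fin (n + 1), ‖w‖ := Finset.sum_le_sum fun k _ => by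
          rw [weakDeriv_integ_succ]; exact (norm_weakDeriv_le k _).trans h1
      _ = _ := by simp

/-- Integration as an isomorphism from `W_p^n × ℂ` to `W_p^(n+1)`. -/
def integEquiv : (Sobolev a b n p × ℂ) ≃L[ℂ] Sobolev a b (n + 1) p :=
  -- By the open mapping theorem the inverse is bounded, which makes the value at `a` a continuous
  -- functional.
  ContinuousLinearEquiv.ofBijective ⟨integ, continuous_integ⟩
    (LinearMap.ker_eq_bot.2 bijective_integ.1) (LinearMap.range_eq_top.2 bijective_integ.2)

theorem integEquiv_apply (w : Sobolev a b n p × ℂ) : integEquiv w = integ w := rfl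

/-- The value at `a` of the continuous representative. -/
def val : Sobolev a b (n + 1) p →L[ℂ] ℂ :=
  (ContinuousLinearMap.snd ℂ (Sobolev a b n p) ℂ).comp integEquiv.symm.toContinuousLinearMap

theorem val_integ (w : Sobolev a b n p × ℂ) : val (integ w) = w.2 := by
  change (integEquiv.symm (integ w)).2 = w.2
  rw [← integEquiv_apply, ContinuousLinearEquiv.symm_apply_apply]

/-- The continuous representative. -/
def rep (u : Sobolev a b (n + 1) p) (t : ℝ) : ℂ :=
  val u + ∫ s in a..t, weakDeriv ⟨1, by omega⟩ u s

theorem integ_derivTo_val (u : Sobolev a b (n + 1) p) :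
    integ (derivTo 1 n (by omega) u, val u) = u := by
  obtain ⟨w, rfl⟩ := bijective_integ.2 u
  rw [derivTo_integ, val_integ]

theorem isPrimitiveOn_rep (u : Sobolev a b (n + 1) p) :
    IsPrimitiveOn a b (rep u) (weakDeriv ⟨1, by omega⟩ u) :=
  isPrimitiveOn_integral _ _

theorem toLp_ae_eq_rep (u : Sobolev a b (n + 1) p) :
    toLp u =ᵐ[volume.restrict (Icc a b)] rep u := by
  conv_lhs => rw [← integ_derivTo_val u]
  exact coeFn_primLp _ _

theorem rep_left (u : Sobolev a b (n + 1) p) : rep u a = val u := by simp [rep]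

theorem continuousOn_rep (u : Sobolev a b (n + 1) p) : ContinuousOn (rep u) (Icc a b) :=
  (isPrimitiveOn_rep u).continuousOn hab.out.le

theorem ext_deriv_val {u v : Sobolev a b (n + 1) p}
    (h : derivTo 1 n (by omega) u = derivTo 1 n (by omega) v) (h' : val u = val v) : u = v := by
  rw [← integ_derivTo_val u, ← integ_derivTo_val v, h, h']

/-- A Sobolev function is a.e. equal to a primitive of its derivative, in a unique way. -/
theorem integ_eq_of_isPrimitiveOn {u : LpI a b p} {v : Sobolev a b n p} {f g : ℝ → ℂ}
    (h : IsPrimitiveOn a b f g) (hu : u =ᵐ[volume.restrict (Icc a b)] f)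
    (hv : toLp v =ᵐ[volume.restrict (Icc a b)] g) : toLp (integ (v, f a)) = u := by
  refine Lp.ext ?_
  filter_upwards [hu, coeFn_primLp (toLp v) (f a), ae_restrict_mem measurableSet_Icc]
    with t h1 h2 ht
  rw [toLp_integ, h2, h1, h.2 t ht, intervalIntegral_congr_Lp hv ht]

theorem val_derivTo_zero {l : ℕ} (h : 0 + (l + 1) ≤ n + 1) (u : Sobolev a b (n + 1) p) :
    val (derivTo 0 (l + 1) h u) = val u := by
  have h1 : toLp (integ (derivTo 1 l (by omega) u, rep u a)) = toLp u :=
    integ_eq_of_isPrimitiveOn (isPrimitiveOn_rep u) (toLp_ae_eq_rep u) (ae_eq_refl _)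
  have h2 : derivTo 0 (l + 1) h u = integ (derivTo 1 l (by omega) u, rep u a) :=
    toLp_injective (by rw [h1, toLp_derivTo_zero])
  rw [h2, val_integ, rep_left]

theorem exists_norm_rep_le : ∃ C : ℝ, 0 ≤ C ∧ ∀ (u : Sobolev a b (n + 1) p), ∀ t ∈ Icc a b,
    ‖rep u t‖ ≤ C * ‖u‖ := by
  obtain ⟨C, hC0, hC⟩ := LpI.exists_integral_norm_le a b p
  refine ⟨‖(val : Sobolev a b (n + 1) p →L[ℂ] ℂ)‖ + C, by positivity, fun u t ht => ?_⟩
  have h1 : ‖∫ s in a..t, weakDeriv ⟨1, by omega⟩ u s‖ ≤ C * ‖u‖ := by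
    rw [intervalIntegral.integral_of_le ht.1]
    refine (norm_integral_le_integral_norm _).trans (le_trans ?_ ((hC _).trans
      (mul_le_mul_of_nonneg_left (norm_weakDeriv_le ⟨1, by omega⟩ u) hC0)))
    exact setIntegral_mono_set (LpI.integrableOn _).norm
      (Eventually.of_forall fun _ => norm_nonneg _)
      (LE.le.eventuallyLE fun s hs => ⟨hs.1.le, hs.2.trans ht.2⟩)
  rw [add_mul]
  exact (norm_add_le _ _).trans (add_le_add (ContinuousLinearMap.le_opNorm _ _) h1)

end Sobolev

/-! ### Products -/

namespace Sobolev

theorem memLp_mul_of_continuousOn {a b : ℝ} {p : ℝ≥0∞} (u : LpI a b p) {f : ℝ → ℂ}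
    (hf : ContinuousOn f (Icc a b)) :
    MemLp (fun t => u t * f t) p (volume.restrict (Icc a b)) := by
  obtain ⟨M, hM⟩ := isCompact_Icc.exists_bound_of_continuousOn hf
  refine (Lp.memLp u).of_le_mul (c := M)
    ((Lp.aestronglyMeasurable u).mul (hf.aestronglyMeasurable measurableSet_Icc)) ?_
  filter_upwards [ae_restrict_mem measurableSet_Icc] with t ht
  rw [norm_mul, mul_comm]
  exact mul_le_mul_of_nonneg_right (hM t ht) (norm_nonneg _)

variable {a b : ℝ} {n : ℕ} {p : ℝ≥0∞} [Fact (1 ≤ p)]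

/-- Functions in `L_p`, as elements of the Sobolev space of order zero. -/
def ofLp (u : LpI a b p) : Sobolev a b 0 p :=
  (⟨u, fun k hk => ⟨u, by rw [Nat.le_zero.1 hk]; exact hasWeakDeriv_zero_self _⟩⟩ :
    sobolevSubmodule a b 0 p)

theorem toLp_ofLp (u : LpI a b p) : toLp (ofLp u) = u := rfl

theorem norm_le_norm_toLp (u : Sobolev a b 0 p) : ‖u‖ ≤ ‖toLp u‖ := by
  refine (norm_le_sum_norm_weakDeriv u).trans (le_of_eq ?_)
  rw [Fin.sum_univ_one, weakDeriv_zero]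

theorem norm_toLp_le (u : Sobolev a b n p) : ‖toLp u‖ ≤ ‖u‖ := by
  rw [← weakDeriv_zero]; exact norm_weakDeriv_le _ _

/-- `w` is the pointwise product of `u` and `v`. -/
def IsMul {k l n : ℕ} (u : Sobolev a b k p) (v : Sobolev a b l p) (w : Sobolev a b n p) : Prop :=
  toLp w =ᵐ[volume.restrict (Icc a b)] fun t => toLp u t * toLp v t

theorem IsMul.unique {k l k' l' n : ℕ} {u : Sobolev a b k p} {v : Sobolev a b l p}
    {u' : Sobolev a b k' p} {v' : Sobolev a b l' p}
    {w w' : Sobolev a b n p} (h : IsMul u v w) (h' : IsMul u' v' w') (hu : toLp u = toLp u')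
    (hv : toLp v = toLp v') : w = w' := by
  refine toLp_injective (Lp.ext (h.trans ?_))
  rw [hu, hv]
  exact h'.symm

variable [hab : Fact (a < b)]

theorem exists_isMul_zero : ∃ C : ℝ, 0 ≤ C ∧ ∀ (u : Sobolev a b 0 p) (v : Sobolev a b 1 p),
    ∃ w : Sobolev a b 0 p, IsMul u v w ∧ ‖w‖ ≤ C * ‖u‖ * ‖v‖ := by
  obtain ⟨C, hC0, hC⟩ := exists_norm_rep_le (a := a) (b := b) (n := 0) (p := p)
  refine ⟨C, hC0, fun u v => ?_⟩
  have hm := memLp_mul_of_continuousOn (toLp u) (continuousOn_rep v)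
  refine ⟨ofLp (hm.toLp _), ?_, (norm_le_norm_toLp _).trans ?_⟩
  · filter_upwards [hm.coeFn_toLp, toLp_ae_eq_rep v] with t h1 h2
    rw [toLp_ofLp, h1, h2]
  · rw [toLp_ofLp]
    refine (Lp.norm_le_mul_norm_of_ae_le_mul (c := C * ‖v‖) (g := toLp u) ?_).trans ?_
    · filter_upwards [hm.coeFn_toLp, ae_restrict_mem measurableSet_Icc] with t h1 ht
      rw [h1, norm_mul, mul_comm]
      exact mul_le_mul_of_nonneg_right (hC v t ht) (norm_nonneg _)
    · rw [mul_right_comm]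
      gcongr
      exact norm_toLp_le u

/-- The product rule read backwards: constructing `u v` as the primitive of `u' v + v' u` with
initial value `u(a) v(a)` gives its smoothness for free. -/
theorem isMul_integ {u v : Sobolev a b (n + 1) p} {w₁ w₂ : Sobolev a b n p}
    (h1 : IsMul (derivTo 1 n (by omega) u) v w₁) (h2 : IsMul (derivTo 1 n (by omega) v) u w₂) :
    IsMul u v (integ (w₁ + w₂, val u * val v)) := by
  have hp := (isPrimitiveOn_rep u).mul (isPrimitiveOn_rep v) hab.out.le
  have hm := memLp_mul_of_continuousOn (toLp u) (continuousOn_rep v)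
  have hu : hm.toLp =ᵐ[volume.restrict (Icc a b)] fun t => rep u t * rep v t := by
    filter_upwards [hm.coeFn_toLp, toLp_ae_eq_rep u] with t h4 h5
    rw [h4, h5]
  have hv : toLp (w₁ + w₂) =ᵐ[volume.restrict (Icc a b)]
      fun t => weakDeriv ⟨1, by omega⟩ u t * rep v t + rep u t * weakDeriv ⟨1, by omega⟩ v t := by
    rw [LinearMap.map_add]
    filter_upwards [Lp.coeFn_add (toLp w₁) (toLp w₂), h1, h2, toLp_ae_eq_rep u,
      toLp_ae_eq_rep v] with t h4 h5 h6 h7 h8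
    rw [h4, Pi.add_apply, h5, h6, ← h7, ← h8, toLp_derivTo, toLp_derivTo, mul_comm (toLp u t)]
  have h3 := integ_eq_of_isPrimitiveOn hp hu hv
  rw [rep_left, rep_left] at h3
  rw [IsMul, h3]
  filter_upwards [hm.coeFn_toLp, toLp_ae_eq_rep v] with t h4 h5
  rw [h5, ← h4]

theorem exists_norm_integ_le : ∃ C : ℝ, 0 ≤ C ∧ ∀ (w : Sobolev a b n p) (c : ℂ),
    ‖integ (w, c)‖ ≤ C * (‖w‖ + ‖c‖) := by
  refine ⟨‖(integEquiv : (Sobolev a b n p × ℂ) ≃L[ℂ] _).toContinuousLinearMap‖, norm_nonneg _,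
    fun w c => (ContinuousLinearMap.le_opNorm
      (integEquiv : (Sobolev a b n p × ℂ) ≃L[ℂ] _).toContinuousLinearMap (w, c)).trans ?_⟩
  refine mul_le_mul_of_nonneg_left ?_ (norm_nonneg _)
  exact max_le (le_add_of_nonneg_right (norm_nonneg _)) (le_add_of_nonneg_left (norm_nonneg _))

theorem exists_isMul_succ_of {C : ℝ} (hC0 : 0 ≤ C)
    (hC : ∀ (u : Sobolev a b n p) (v : Sobolev a b (n + 1) p),
      ∃ w : Sobolev a b n p, IsMul u v w ∧ ‖w‖ ≤ C * ‖u‖ * ‖v‖) :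
    ∃ C' : ℝ, 0 ≤ C' ∧ ∀ u v : Sobolev a b (n + 1) p,
      ∃ w : Sobolev a b (n + 1) p, IsMul u v w ∧ ‖w‖ ≤ C' * ‖u‖ * ‖v‖ := by
  obtain ⟨J, hJ0, hJ⟩ := exists_norm_integ_le (a := a) (b := b) (n := n) (p := p)
  obtain ⟨D, hD0, hD⟩ : ∃ D : ℝ, 0 ≤ D ∧ ∀ u : Sobolev a b (n + 1) p,
      ‖(derivTo 1 n (by omega) u : Sobolev a b n p)‖ ≤ D * ‖u‖ :=
    ⟨_, norm_nonneg _, ContinuousLinearMap.le_opNorm _⟩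
  obtain ⟨V, hV0, hV⟩ : ∃ V : ℝ, 0 ≤ V ∧ ∀ u : Sobolev a b (n + 1) p, ‖val u‖ ≤ V * ‖u‖ :=
    ⟨_, norm_nonneg _, ContinuousLinearMap.le_opNorm _⟩
  refine ⟨J * (2 * C * D + V * V), by positivity, fun u v => ?_⟩
  obtain ⟨w₁, h1, h1'⟩ := hC (derivTo 1 n (by omega) u) v
  obtain ⟨w₂, h2, h2'⟩ := hC (derivTo 1 n (by omega) v) u
  refine ⟨integ (w₁ + w₂, val u * val v), isMul_integ h1 h2, (hJ _ _).trans ?_⟩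
  have e5 : ‖w₁‖ ≤ C * D * ‖u‖ * ‖v‖ := by
    refine h1'.trans ?_
    calc _ ≤ C * (D * ‖u‖) * ‖v‖ := by gcongr; exact hD u
      _ = _ := by ring
  have e6 : ‖w₂‖ ≤ C * D * ‖u‖ * ‖v‖ := by
    refine h2'.trans ?_
    calc _ ≤ C * (D * ‖v‖) * ‖u‖ := by gcongr; exact hD v
      _ = _ := by ring
  have e7 : ‖val u * val v‖ ≤ V * V * ‖u‖ * ‖v‖ := by
    rw [norm_mul]
    calc ‖val u‖ * ‖val v‖ ≤ (V * ‖u‖) * (V * ‖v‖) :=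
          mul_le_mul (hV u) (hV v) (norm_nonneg _) (by positivity)
      _ = _ := by ring
  rw [mul_assoc J, mul_assoc J]
  refine mul_le_mul_of_nonneg_left ?_ hJ0
  linarith [norm_add_le w₁ w₂]

/-- `L_p` is not an algebra in general, so one factor carries an extra derivative and is bounded.
For the induction step, the bound at order `n` makes `W_p^{n+1}` an algebra through the product
rule, and the smoother factor is then embedded into it. -/
theorem exists_isMul (a b : ℝ) (n : ℕ) (p : ℝ≥0∞) [Fact (1 ≤ p)] [Fact (a < b)] :
    ∃ C : ℝ, 0 ≤ C ∧ ∀ (u : Sobolev a b n p) (v : Sobolev a b (n + 1) p),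
      ∃ w : Sobolev a b n p, IsMul u v w ∧ ‖w‖ ≤ C * ‖u‖ * ‖v‖ := by
  induction n with
  | zero => exact exists_isMul_zero
  | succ n ih =>
    obtain ⟨C, hC0, hC⟩ := ih
    obtain ⟨C', hC0', hC'⟩ := exists_isMul_succ_of hC0 hC
    let E : Sobolev a b (n + 2) p →L[ℂ] Sobolev a b (n + 1) p := derivTo 0 (n + 1) (by omega)
    refine ⟨C' * ‖E‖, by positivity, fun u v => ?_⟩
    obtain ⟨w, hw, hw'⟩ := hC' u (E v)
    refine ⟨w, ?_, hw'.trans ?_⟩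
    · have h : toLp (E v) = toLp v := toLp_derivTo_zero _ _
      rw [IsMul, h] at hw
      exact hw
    · calc C' * ‖u‖ * ‖E v‖ ≤ C' * ‖u‖ * (‖E‖ * ‖v‖) := by
            gcongr; exact E.le_opNorm v
        _ = _ := by ring

theorem exists_isMul_succ (u v : Sobolev a b (n + 1) p) :
    ∃ w : Sobolev a b (n + 1) p, IsMul u v w := by
  obtain ⟨C, hC0, hC⟩ := exists_isMul a b n p
  obtain ⟨C', -, hC'⟩ := exists_isMul_succ_of hC0 hC
  obtain ⟨w, hw, -⟩ := hC' u v
  exact ⟨w, hw⟩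

/-- The pointwise product of `W_p^n` and `W_p^(n+1)`. -/
def mul : Sobolev a b n p →L[ℂ] Sobolev a b (n + 1) p →L[ℂ] Sobolev a b n p :=
  LinearMap.mkContinuous₂
    (LinearMap.mk₂ ℂ (fun u v => ((exists_isMul a b n p).choose_spec.2 u v).choose)
      (fun u₁ u₂ v => by
        refine toLp_injective (Lp.ext ?_)
        rw [map_add]
        filter_upwards [((exists_isMul a b n p).choose_spec.2 (u₁ + u₂) v).choose_spec.1,
          ((exists_isMul a b n p).choose_spec.2 u₁ v).choose_spec.1,
          ((exists_isMul a b n p).choose_spec.2 u₂ v).choose_spec.1,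
          Lp.coeFn_add (toLp u₁) (toLp u₂), Lp.coeFn_add
          (toLp ((exists_isMul a b n p).choose_spec.2 u₁ v).choose)
          (toLp ((exists_isMul a b n p).choose_spec.2 u₂ v).choose)] with t h1 h2 h3 h4 h5
        rw [h1, h5, Pi.add_apply, h2, h3, map_add, h4, Pi.add_apply, add_mul])
      (fun c u v => by
        refine toLp_injective (Lp.ext ?_)
        rw [map_smul]
        filter_upwards [((exists_isMul a b n p).choose_spec.2 (c • u) v).choose_spec.1,
          ((exists_isMul a b n p).choose_spec.2 u v).choose_spec.1,
          Lp.coeFn_smul c (toLp u), Lp.coeFn_smul c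
          (toLp ((exists_isMul a b n p).choose_spec.2 u v).choose)] with t h1 h2 h3 h4
        rw [h1, h4, Pi.smul_apply, h2, map_smul, h3, Pi.smul_apply, smul_mul_assoc])
      (fun u v₁ v₂ => by
        refine toLp_injective (Lp.ext ?_)
        rw [map_add]
        filter_upwards [((exists_isMul a b n p).choose_spec.2 u (v₁ + v₂)).choose_spec.1,
          ((exists_isMul a b n p).choose_spec.2 u v₁).choose_spec.1,
          ((exists_isMul a b n p).choose_spec.2 u v₂).choose_spec.1,
          Lp.coeFn_add (toLp v₁) (toLp v₂), Lp.coeFn_add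
          (toLp ((exists_isMul a b n p).choose_spec.2 u v₁).choose)
          (toLp ((exists_isMul a b n p).choose_spec.2 u v₂).choose)] with t h1 h2 h3 h4 h5
        rw [h1, h5, Pi.add_apply, h2, h3, map_add, h4, Pi.add_apply, mul_add])
      (fun c u v => by
        refine toLp_injective (Lp.ext ?_)
        rw [map_smul]
        filter_upwards [((exists_isMul a b n p).choose_spec.2 u (c • v)).choose_spec.1,
          ((exists_isMul a b n p).choose_spec.2 u v).choose_spec.1,
          Lp.coeFn_smul c (toLp v), Lp.coeFn_smul c
          (toLp ((exists_isMul a b n p).choose_spec.2 u v).choose)] with t h1 h2 h3 h4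
        rw [h1, h4, Pi.smul_apply, h2, map_smul, h3, Pi.smul_apply, mul_smul_comm]))
    (exists_isMul a b n p).choose fun u v =>
      ((exists_isMul a b n p).choose_spec.2 u v).choose_spec.2

theorem isMul_mul (u : Sobolev a b n p) (v : Sobolev a b (n + 1) p) : IsMul u v (mul u v) :=
  ((exists_isMul a b n p).choose_spec.2 u v).choose_spec.1

end Sobolev

/-! ### Linear Volterra equations with integrable kernels -/

theorem integrableOn_norm {E : Type*} [NormedAddCommGroup E] {v : ℝ → E} {s : Set ℝ}
    (hv : IntegrableOn v s) : IntegrableOn (fun t => ‖v t‖) s :=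
  hv.norm

/-- With an exponential weight, the integral of an integrable function can be made small. -/
theorem exists_integral_exp_mul_le {a b : ℝ} {k : ℝ → ℝ} (hk : IntegrableOn k (Icc a b)) :
    ∃ r : ℝ, ∀ t ∈ Icc a b, ∫ s in a..t, Real.exp (r * (s - t)) * ‖k s‖ ≤ 1 / 2 := by
  -- An `L_1` approximation by a bounded `g` costs `1/4`. The weight makes the contribution of `g`
  -- at most `‖g‖ / r`, which is at most `1/4` for the `r` chosen below.
  obtain ⟨g, hg, -⟩ := Integrable.exists_boundedContinuous_integral_sub_le hk
    (ε := 1 / 4) (by norm_num)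
  refine ⟨4 * (‖g‖ + 1), fun t ht => ?_⟩
  set r := 4 * (‖g‖ + 1) with hr
  have hr0 : 0 < r := by positivity
  have ha : a ∈ Icc a b := ⟨le_rfl, ht.1.trans ht.2⟩
  have hexp : Continuous fun s => Real.exp (r * (s - t)) := by fun_prop
  have hgc : IntegrableOn g (Icc a b) := g.continuous.continuousOn.integrableOn_Icc
  have i1 : IntervalIntegrable (fun s => Real.exp (r * (s - t)) * ‖g‖) volume a t :=
    (hexp.mul continuous_const).intervalIntegrable _ _
  have i2 : IntervalIntegrable (fun s => ‖k s - g s‖) volume a t :=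
    (integrableOn_norm (hk.sub hgc)).intervalIntegrable_of_mem_Icc ha ht
  have i3 : IntervalIntegrable (fun s => Real.exp (r * (s - t)) * ‖k s‖) volume a t :=
    ((integrableOn_norm hk).continuousOn_mul hexp.continuousOn
      isCompact_Icc).intervalIntegrable_of_mem_Icc ha ht
  have e1 : ∫ s in a..t, Real.exp (r * (s - t)) * ‖k s‖ ≤
      ∫ s in a..t, (Real.exp (r * (s - t)) * ‖g‖ + ‖k s - g s‖) := by
    refine intervalIntegral.integral_mono_on ht.1 i3 (i1.add i2) fun s hs => ?_
    have h1 : Real.exp (r * (s - t)) ≤ 1 :=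
      Real.exp_le_one_iff.2 (mul_nonpos_of_nonneg_of_nonpos hr0.le (by linarith [hs.2]))
    have h2 : ‖k s‖ ≤ ‖g‖ + ‖k s - g s‖ :=
      (norm_le_norm_add_norm_sub (g s) (k s)).trans (by
        rw [norm_sub_rev]; gcongr; exact g.norm_coe_le_norm s)
    calc _ ≤ Real.exp (r * (s - t)) * (‖g‖ + ‖k s - g s‖) := by gcongr
      _ ≤ _ := by
        rw [mul_add]
        gcongr
        exact mul_le_of_le_one_left (norm_nonneg _) h1
  have e2 : ∫ s in a..t, Real.exp (r * (s - t)) = (1 - Real.exp (r * (a - t))) / r := by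
    rw [intervalIntegral.integral_eq_sub_of_hasDerivAt
      (f := fun s => Real.exp (r * (s - t)) / r) (fun s _ => ?_) (hexp.intervalIntegrable _ _)]
    · simp [sub_div]
    · have h := ((((hasDerivAt_id s).sub_const t).const_mul r).exp).div_const r
      simp only [id] at h
      rwa [mul_one, mul_div_cancel_right₀ _ hr0.ne'] at h
  have e3 : ∫ s in a..t, ‖k s - g s‖ ≤ 1 / 4 := by
    refine le_trans ?_ hg
    rw [intervalIntegral.integral_of_le ht.1]
    exact setIntegral_mono_set (hk.sub hgc).norm (Eventually.of_forall fun _ => norm_nonneg _)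
      (LE.le.eventuallyLE fun s hs => ⟨hs.1.le, hs.2.trans ht.2⟩)
  rw [intervalIntegral.integral_add i1 i2, intervalIntegral.integral_mul_const, e2] at e1
  have e4 : (1 - Real.exp (r * (a - t))) / r * ‖g‖ ≤ 1 / 4 := by
    rw [div_mul_eq_mul_div, div_le_iff₀ hr0]
    have h1 := Real.exp_pos (r * (a - t))
    nlinarith [norm_nonneg g]
  linarith

section Volterra

variable {ι : Type*} [Fintype ι] {a b : ℝ}

/-- `z` solves the linear system of Volterra equations `z = h + ∫_a^t F z`. -/
def IsVolterraSolution (a b : ℝ) (F : ι → ι → ℝ → ℂ) (h z : ι → ℝ → ℂ) : Prop :=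
  (∀ i, ContinuousOn (z i) (Icc a b)) ∧
    ∀ i, ∀ t ∈ Icc a b, z i t = h i t + ∑ j, ∫ s in a..t, F i j s * z j s

theorem continuousOn_integral {v : ℝ → ℂ} (hab : a ≤ b) (hv : IntegrableOn v (Icc a b)) :
    ContinuousOn (fun t => ∫ s in a..t, v s) (Icc a b) :=
  IsPrimitiveOn.continuousOn (v := v) ⟨hv, fun t _ => by simp⟩ hab

/-- The Volterra operator, conjugated by an exponential weight. -/
def weightedVolterra (hab : a ≤ b) (r : ℝ) {F : ι → ι → ℝ → ℂ} {h : ι → ℝ → ℂ}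
    (hF : ∀ i j, IntegrableOn (F i j) (Icc a b)) (hh : ∀ i, ContinuousOn (h i) (Icc a b))
    (x : C(Icc a b, ι → ℂ)) : C(Icc a b, ι → ℂ) where
  toFun t i := (Real.exp (-(r * t)) : ℂ) * (h i t + ∑ j, ∫ s in a..t,
    F i j s * ((Real.exp (r * s) : ℂ) * IccExtend hab x s j))
  continuous_toFun := by
    refine continuous_pi fun i => ?_
    have hc : ContinuousOn (fun t : ℝ => (Real.exp (-(r * t)) : ℂ) * (h i t + ∑ j, ∫ s in a..t,
        F i j s * ((Real.exp (r * s) : ℂ) * IccExtend hab x s j))) (Icc a b) := by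
      refine ContinuousOn.mul (by fun_prop) ((hh i).add (continuousOn_finsetSum _ fun j _ => ?_))
      refine continuousOn_integral hab ((hF i j).mul_continuousOn ?_ isCompact_Icc)
      have : Continuous (fun s => IccExtend hab x s j) :=
        (continuous_apply j).comp x.continuous.Icc_extend'
      fun_prop
    exact hc.domRestrict

theorem isVolterraSolution_of_weightedVolterra_eq {hab : a ≤ b} {r : ℝ} {F : ι → ι → ℝ → ℂ}
    {h : ι → ℝ → ℂ} {hF : ∀ i j, IntegrableOn (F i j) (Icc a b)}
    {hh : ∀ i, ContinuousOn (h i) (Icc a b)} {x : C(Icc a b, ι → ℂ)}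
    (hx : weightedVolterra hab r hF hh x = x) :
    IsVolterraSolution a b F h fun i t => (Real.exp (r * t) : ℂ) * IccExtend hab x t i := by
  constructor
  · intro i
    have : Continuous (fun s => IccExtend hab x s i) :=
      (continuous_apply i).comp x.continuous.Icc_extend'
    fun_prop
  · intro i t ht
    have h1 := congrFun (congrArg (fun y : C(Icc a b, ι → ℂ) => y ⟨t, ht⟩) hx) i
    beta_reduce
    rw [IccExtend_of_mem hab x ht, ← h1]
    simp only [weightedVolterra, ContinuousMap.coe_mk]
    rw [← mul_assoc, ← Complex.ofReal_mul, ← Real.exp_add]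
    simp

theorem weightedVolterra_eq_of_isVolterraSolution {hab : a ≤ b} {r : ℝ} {F : ι → ι → ℝ → ℂ}
    {h z : ι → ℝ → ℂ} (hF : ∀ i j, IntegrableOn (F i j) (Icc a b))
    (hh : ∀ i, ContinuousOn (h i) (Icc a b)) (hz : IsVolterraSolution a b F h z) :
    ∃ x : C(Icc a b, ι → ℂ), weightedVolterra hab r hF hh x = x ∧
      ∀ i, ∀ t (ht : t ∈ Icc a b), x ⟨t, ht⟩ i = (Real.exp (-(r * t)) : ℂ) * z i t := by
  have hc : ∀ i, ContinuousOn (fun t : ℝ => (Real.exp (-(r * t)) : ℂ) * z i t) (Icc a b) :=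
    fun i => ContinuousOn.mul (by fun_prop) (hz.1 i)
  refine ⟨⟨fun t i => (Real.exp (-(r * t)) : ℂ) * z i t, continuous_pi fun i => (hc i).domRestrict⟩,
    ?_, fun i t ht => rfl⟩
  ext t i
  simp only [weightedVolterra, ContinuousMap.coe_mk]
  rw [hz.2 i t t.2]
  congr 2
  refine Finset.sum_congr rfl fun j _ => intervalIntegral.integral_congr fun s hs => ?_
  have hs' : s ∈ Icc a b := uIcc_subset_Icc ⟨le_rfl, hab⟩ t.2 hs
  simp only [IccExtend_of_mem hab _ hs']
  rw [← mul_assoc (Complex.ofReal _), ← Complex.ofReal_mul, ← Real.exp_add]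
  simp

/-- In the variable `e^{-rt} z` the kernel becomes `e^{r(s-t)} F`, whose integral is small for a
suitable `r`. A single step therefore contracts on all of `[a,b]`, without subdividing. The sum of
all `‖F i j‖` serves as one scalar majorant. -/
theorem exists_contractingWith_weightedVolterra (hab : a ≤ b) {F : ι → ι → ℝ → ℂ}
    (hF : ∀ i j, IntegrableOn (F i j) (Icc a b)) {h : ι → ℝ → ℂ}
    (hh : ∀ i, ContinuousOn (h i) (Icc a b)) :
    ∃ r : ℝ, ContractingWith (1 / 2) (weightedVolterra hab r hF hh) := by
  have hk : IntegrableOn (fun s => ∑ i, ∑ j, ‖F i j s‖) (Icc a b) :=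
    integrable_finsetSum _ fun i _ => integrable_finsetSum _ fun j _ => (hF i j).norm
  obtain ⟨r, hr⟩ := exists_integral_exp_mul_le hk
  refine ⟨r, by norm_num [← NNReal.coe_lt_coe], LipschitzWith.of_dist_le_mul fun x y => ?_⟩
  rw [ContinuousMap.dist_le (by positivity)]
  intro t
  rw [dist_pi_le_iff (by positivity)]
  intro i
  have ha : a ∈ Icc a b := ⟨le_rfl, hab⟩
  have hint : ∀ (w : C(Icc a b, ι → ℂ)) (j : ι), IntervalIntegrable
      (fun s => F i j s * ((Real.exp (r * s) : ℂ) * IccExtend hab w s j)) volume a t := by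
    intro w j
    have : Continuous (fun s => IccExtend hab w s j) :=
      (continuous_apply j).comp w.continuous.Icc_extend'
    exact ((hF i j).mul_continuousOn (by fun_prop) isCompact_Icc).intervalIntegrable_of_mem_Icc
      ha t.2
  have hexp : Continuous fun s => Real.exp (r * (s - t)) := by fun_prop
  have hFi : ∀ j, IntervalIntegrable (fun s => Real.exp (r * (s - t)) * ‖F i j s‖) volume a t :=
    fun j => ((integrableOn_norm (hF i j)).continuousOn_mul hexp.continuousOn
      isCompact_Icc).intervalIntegrable_of_mem_Icc ha t.2
  have hterm : ∀ j, ‖(Real.exp (-(r * t)) : ℂ) * ∫ s in a..t, F i j s *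
      ((Real.exp (r * s) : ℂ) * (IccExtend hab x s j - IccExtend hab y s j))‖ ≤
      (∫ s in a..t, Real.exp (r * (s - t)) * ‖F i j s‖) * dist x y := by
    intro j
    rw [← intervalIntegral.integral_const_mul, ← intervalIntegral.integral_mul_const]
    refine intervalIntegral.norm_integral_le_of_norm_le t.2.1 (Eventually.of_forall fun s hs => ?_)
      ((hFi j).mul_const _)
    have h1 : ‖IccExtend hab x s j - IccExtend hab y s j‖ ≤ dist x y := by
      rw [← dist_eq_norm]
      exact (dist_le_pi_dist _ _ j).trans (ContinuousMap.dist_apply_le_dist _)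
    rw [norm_mul, norm_mul, norm_mul, Complex.norm_real, Complex.norm_real, Real.norm_eq_abs,
      Real.norm_eq_abs, Real.abs_exp, Real.abs_exp]
    calc _ = (Real.exp (-(r * t)) * Real.exp (r * s)) * ‖F i j s‖ *
          ‖IccExtend hab x s j - IccExtend hab y s j‖ := by ring
      _ ≤ _ := by
        rw [← Real.exp_add, show -(r * t) + r * s = r * (s - t) by ring]
        gcongr
  have heq : weightedVolterra hab r hF hh x t i - weightedVolterra hab r hF hh y t i =
      ∑ j, (Real.exp (-(r * t)) : ℂ) * ∫ s in a..t, F i j s *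
      ((Real.exp (r * s) : ℂ) * (IccExtend hab x s j - IccExtend hab y s j)) := by
    simp only [weightedVolterra, ContinuousMap.coe_mk]
    rw [← mul_sub, add_sub_add_left_eq_sub, ← Finset.sum_sub_distrib, Finset.mul_sum]
    refine Finset.sum_congr rfl fun j _ => ?_
    rw [← intervalIntegral.integral_sub (hint x j) (hint y j)]
    simp only [mul_sub]
  rw [dist_eq_norm, heq]
  refine (norm_sum_le _ _).trans ((Finset.sum_le_sum fun j _ => hterm j).trans ?_)
  rw [← Finset.sum_mul]
  refine mul_le_mul_of_nonneg_right ?_ dist_nonneg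
  rw [← intervalIntegral.integral_finsetSum fun j _ => hFi j]
  refine le_trans ?_ ((hr t t.2).trans (by norm_num))
  refine intervalIntegral.integral_mono_on t.2.1 (by
      simpa only [Finset.sum_fn] using IntervalIntegrable.sum Finset.univ fun j _ => hFi j)
    (((integrableOn_norm hk).continuousOn_mul hexp.continuousOn
      isCompact_Icc).intervalIntegrable_of_mem_Icc ha t.2) fun s _ => ?_
  rw [← Finset.mul_sum]
  gcongr
  refine le_trans ?_ (le_abs_self _)
  exact Finset.single_le_sum (f := fun i => ∑ j, ‖F i j s‖)
    (fun i _ => Finset.sum_nonneg fun j _ => norm_nonneg _) (Finset.mem_univ i)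

theorem exists_isVolterraSolution (hab : a ≤ b) {F : ι → ι → ℝ → ℂ}
    (hF : ∀ i j, IntegrableOn (F i j) (Icc a b)) {h : ι → ℝ → ℂ}
    (hh : ∀ i, ContinuousOn (h i) (Icc a b)) : ∃ z, IsVolterraSolution a b F h z := by
  obtain ⟨r, hr⟩ := exists_contractingWith_weightedVolterra hab hF hh
  exact ⟨_, isVolterraSolution_of_weightedVolterra_eq hr.fixedPoint_isFixedPt⟩

theorem IsVolterraSolution.eqOn (hab : a ≤ b) {F : ι → ι → ℝ → ℂ}
    (hF : ∀ i j, IntegrableOn (F i j) (Icc a b)) {h : ι → ℝ → ℂ}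
    (hh : ∀ i, ContinuousOn (h i) (Icc a b)) {z z' : ι → ℝ → ℂ}
    (hz : IsVolterraSolution a b F h z) (hz' : IsVolterraSolution a b F h z') (i : ι) :
    EqOn (z i) (z' i) (Icc a b) := by
  obtain ⟨r, hr⟩ := exists_contractingWith_weightedVolterra hab hF hh
  obtain ⟨x, hx, hxz⟩ := weightedVolterra_eq_of_isVolterraSolution (hab := hab) (r := r) hF hh hz
  obtain ⟨y, hy, hyz⟩ := weightedVolterra_eq_of_isVolterraSolution (hab := hab) (r := r) hF hh hz'
  have hxy : x = y := hr.fixedPoint_unique' hx hy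
  intro t ht
  have h1 := hxz i t ht
  rw [hxy, hyz i t ht] at h1
  exact (mul_left_cancel₀ (Complex.ofReal_ne_zero.2 (Real.exp_ne_zero _)) h1).symm

end Volterra

/-! ### First-order linear systems in Sobolev spaces -/

namespace Sobolev

variable {a b : ℝ} {n : ℕ} {p : ℝ≥0∞} [Fact (1 ≤ p)]

/-- The functional `v ↦ ∫_a^t v` on `L_p([a,b], ℂ)`. -/
def integralTo {t : ℝ} (ht : t ∈ Icc a b) : LpI a b p →ₗ[ℂ] ℂ where
  toFun v := ∫ s in a..t, v s
  map_add' u v := by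
    have ha : a ∈ Icc a b := ⟨le_rfl, ht.1.trans ht.2⟩
    rw [intervalIntegral_congr_Lp (Lp.coeFn_add u v) ht]
    exact intervalIntegral.integral_add (u.integrableOn.intervalIntegrable_of_mem_Icc ha ht)
      (v.integrableOn.intervalIntegrable_of_mem_Icc ha ht)
  map_smul' c v := by
    rw [intervalIntegral_congr_Lp (Lp.coeFn_smul c v) ht]
    exact intervalIntegral.integral_smul c v

theorem integralTo_apply {t : ℝ} (ht : t ∈ Icc a b) (v : LpI a b p) :
    integralTo ht v = ∫ s in a..t, v s := rfl

variable [hab : Fact (a < b)]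

theorem rep_eq_integralTo (u : Sobolev a b (n + 1) p) {t : ℝ} (ht : t ∈ Icc a b) :
    rep u t = val u + integralTo ht (toLp (derivTo 1 n (by omega) u : Sobolev a b n p)) := rfl

theorem integralTo_mul (u : Sobolev a b n p) (v : Sobolev a b (n + 1) p) {t : ℝ}
    (ht : t ∈ Icc a b) : integralTo ht (toLp (mul u v)) = ∫ s in a..t, toLp u s * rep v s := by
  rw [integralTo_apply]
  refine intervalIntegral_congr_Lp ?_ ht
  filter_upwards [isMul_mul u v, toLp_ae_eq_rep v] with s h1 h2
  rw [h1, h2]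

variable {ι : Type*} [Fintype ι]

/-- `z` solves the Cauchy problem `z' = F z + g`, `z(a) = z₀`. -/
def IsSystemSolution (F : ι → ι → Sobolev a b n p) (g : ι → Sobolev a b n p) (z₀ : ι → ℂ)
    (z : ι → Sobolev a b (n + 1) p) : Prop :=
  ∀ i, derivTo 1 n (by omega) (z i) = ∑ j, mul (F i j) (z j) + g i ∧ val (z i) = z₀ i

theorem IsSystemSolution.isVolterraSolution {F : ι → ι → Sobolev a b n p}
    {g : ι → Sobolev a b n p} {z₀ : ι → ℂ} {z : ι → Sobolev a b (n + 1) p}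
    (hz : IsSystemSolution F g z₀ z) :
    IsVolterraSolution a b (fun i j => toLp (F i j)) (fun i t => z₀ i + ∫ s in a..t, toLp (g i) s)
      (fun i => rep (z i)) := by
  refine ⟨fun i => continuousOn_rep _, fun i t ht => ?_⟩
  beta_reduce
  rw [rep_eq_integralTo _ ht, (hz i).1, (hz i).2, map_add, map_add, map_sum, map_sum]
  simp only [integralTo_mul]
  rw [integralTo_apply]
  ring

theorem IsSystemSolution.unique {F : ι → ι → Sobolev a b n p}
    {g : ι → Sobolev a b n p} {z₀ : ι → ℂ} {z z' : ι → Sobolev a b (n + 1) p}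
    (hz : IsSystemSolution F g z₀ z) (hz' : IsSystemSolution F g z₀ z') : z = z' := by
  ext1 i
  have h := hz.isVolterraSolution.eqOn hab.out.le (fun i j => LpI.integrableOn _)
    (fun i => (isPrimitiveOn_integral _ _).continuousOn hab.out.le) hz'.isVolterraSolution i
  refine toLp_injective (Lp.ext ?_)
  filter_upwards [toLp_ae_eq_rep (z i), toLp_ae_eq_rep (z' i), ae_restrict_mem measurableSet_Icc]
    with t h1 h2 ht
  rw [h1, h2, h ht]

/-- The Volterra solution `x` is only known to be continuous, but then `F x + g` is in `L_p`, and
its primitive is an element of `W_p^1` that agrees with `x` a.e. -/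
theorem exists_isSystemSolution_zero (F : ι → ι → Sobolev a b 0 p) (g : ι → Sobolev a b 0 p)
    (z₀ : ι → ℂ) : ∃ z, IsSystemSolution F g z₀ z := by
  obtain ⟨x, hx, hx'⟩ := exists_isVolterraSolution hab.out.le
    (F := fun i j => toLp (F i j)) (fun i j => LpI.integrableOn _)
    (h := fun i t => z₀ i + ∫ s in a..t, toLp (g i) s)
    (fun i => (isPrimitiveOn_integral _ _).continuousOn hab.out.le)
  have hm := fun i j => memLp_mul_of_continuousOn (toLp (F i j)) (hx j)
  let w : ι → ι → Sobolev a b 0 p := fun i j => ofLp ((hm i j).toLp _)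
  have hw : ∀ i j, toLp (w i j) =ᵐ[volume.restrict (Icc a b)] fun t => toLp (F i j) t * x j t :=
    fun i j => (hm i j).coeFn_toLp
  let z : ι → Sobolev a b 1 p := fun i => integ (∑ j, w i j + g i, z₀ i)
  have hz : ∀ i, toLp (z i) =ᵐ[volume.restrict (Icc a b)] x i := by
    intro i
    filter_upwards [toLp_ae_eq_rep (z i), ae_restrict_mem measurableSet_Icc] with t h1 ht
    rw [h1, rep_eq_integralTo _ ht, derivTo_integ, val_integ, hx' i t ht]
    simp only [map_add, map_sum, integralTo_apply]
    rw [Finset.sum_congr rfl fun (j : ι) _ => intervalIntegral_congr_Lp (hw i j) ht]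
    ring
  have hd : ∀ i, derivTo 1 0 (by omega) (z i) = ∑ j, w i j + g i := fun i => derivTo_integ _
  refine ⟨z, fun i => ⟨?_, val_integ _⟩⟩
  rw [hd]
  congr 1
  refine Finset.sum_congr rfl fun j _ => toLp_injective (Lp.ext ?_)
  filter_upwards [hw i j, isMul_mul (F i j) (z j), hz j] with t h1 h2 h3
  rw [h1, h2, h3]

/-- Bootstrapping: the solution `x` at the lower order is already in `W_p^{n+1}`, where products
stay, so `F x + g` is in `W_p^{n+1}` and integrating it gains one more derivative. -/
theorem exists_isSystemSolution (F : ι → ι → Sobolev a b n p) (g : ι → Sobolev a b n p)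
    (z₀ : ι → ℂ) : ∃ z, IsSystemSolution F g z₀ z := by
  induction n with
  | zero => exact exists_isSystemSolution_zero F g z₀
  | succ n ih =>
    let E : Sobolev a b (n + 1) p →L[ℂ] Sobolev a b n p := derivTo 0 n (by omega)
    have hE : ∀ u, toLp (E u) = toLp u := toLp_derivTo_zero _
    obtain ⟨x, hx⟩ := ih (fun i j => E (F i j)) (fun i => E (g i))
    choose w hw using fun i j => exists_isMul_succ (F i j) (x j)
    let z : ι → Sobolev a b (n + 2) p := fun i => integ (∑ j, w i j + g i, z₀ i)
    have hd : ∀ i, derivTo 1 (n + 1) (by omega) (z i) = ∑ j, w i j + g i :=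
      fun i => derivTo_integ _
    -- The smoother `z` is the old solution: both have the same derivative and the same value at
    -- `a`.
    have hz : ∀ i, derivTo 0 (n + 1) (by omega) (z i) = x i := by
      intro i
      refine ext_deriv_val ?_ ?_
      · rw [(hx i).1, derivTo_derivTo]
        have h1 : derivTo (0 + 1) n (by omega) (z i) = E (∑ j, w i j + g i) := by
          refine toLp_injective ?_
          rw [hE, ← hd]
          rfl
        rw [h1, map_add, map_sum]
        congr 1
        refine Finset.sum_congr rfl fun j _ => ?_
        refine IsMul.unique (u := F i j) (v := x j) ?_ (isMul_mul (E (F i j)) (x j)) (hE _).symm rfl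
        rw [IsMul, hE]
        exact hw i j
      · rw [val_derivTo_zero, val_integ, (hx i).2]
    refine ⟨z, fun i => ⟨?_, val_integ _⟩⟩
    rw [hd]
    congr 1
    refine Finset.sum_congr rfl fun j _ => (hw i j).unique (isMul_mul (F i j) (z j)) rfl ?_
    rw [← hz j, toLp_derivTo_zero]

end Sobolev

/-! ### The differential operator of order `r` -/

namespace Sobolev

variable {a b : ℝ} {n m r : ℕ} {p : ℝ≥0∞} [Fact (1 ≤ p)]

/-- The derivative of order `k < r` of a function in `W_p^(n+r)`. -/
def lowerDeriv (k : Fin r) : Sobolev a b (n + r) p →L[ℂ] Sobolev a b (n + 1) p :=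
  derivTo k (n + 1) (by omega)

/-- The derivative of order `r` of a function in `W_p^(n+r)`. -/
def topDeriv : Sobolev a b (n + r) p →L[ℂ] Sobolev a b n p :=
  derivTo r n (by omega)

theorem toLp_sum_ae {κ : Type*} (s : Finset κ) (u : κ → Sobolev a b n p) :
    toLp (∑ k ∈ s, u k) =ᵐ[volume.restrict (Icc a b)] fun t => ∑ k ∈ s, toLp (u k) t := by
  classical
  induction s using Finset.induction_on with
  | empty =>
    rw [Finset.sum_empty, map_zero]
    simp only [Finset.sum_empty]
    exact Lp.coeFn_zero ℂ p (volume.restrict (Icc a b))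
  | insert k s hk ih =>
    rw [Finset.sum_insert hk, map_add]
    filter_upwards [ih, Lp.coeFn_add (toLp (u k)) (toLp (∑ k ∈ s, u k))] with t h1 h2
    rw [h2, Pi.add_apply, h1, Finset.sum_insert hk]

theorem toLp_neg_ae (u : Sobolev a b n p) :
    toLp (-u) =ᵐ[volume.restrict (Icc a b)] fun t => -toLp u t := by
  rw [map_neg]
  exact Lp.coeFn_neg _

theorem derivTo_lowerDeriv_of_lt {k : Fin r} (h : (k : ℕ) + 1 < r) (y : Sobolev a b (n + r) p) :
    (derivTo 1 n (by omega) (lowerDeriv k y) : Sobolev a b n p) =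
      derivTo 0 n (by omega) (lowerDeriv ⟨k + 1, h⟩ y) := by
  rw [lowerDeriv, lowerDeriv, derivTo_derivTo, derivTo_derivTo]

theorem derivTo_lowerDeriv_of_not_lt {k : Fin r} (h : ¬ (k : ℕ) + 1 < r)
    (y : Sobolev a b (n + r) p) :
    (derivTo 1 n (by omega) (lowerDeriv k y) : Sobolev a b n p) = topDeriv y := by
  have hk : (k : ℕ) + 1 = r := by omega
  rw [lowerDeriv, topDeriv, derivTo_derivTo]
  simp only [hk]

theorem eq_of_lowerDeriv_eq (hr : 1 ≤ r) {y y' : Sobolev a b (n + r) p}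
    (h : lowerDeriv ⟨0, hr⟩ y = lowerDeriv ⟨0, hr⟩ y') : y = y' := by
  refine toLp_injective ?_
  rw [← toLp_derivTo_zero (l := n + 1) (by omega) y, ← toLp_derivTo_zero (l := n + 1) (by omega) y']
  exact congrArg toLp h

theorem exists_lowerDeriv_eq (hr : 1 ≤ r) (u : Fin r → Sobolev a b (n + 1) p)
    (hu : ∀ (k : Fin r) (h : (k : ℕ) + 1 < r), (derivTo 1 n (by omega) (u k) : Sobolev a b n p) =
      derivTo 0 n (by omega) (u ⟨k + 1, h⟩)) :
    ∃ y : Sobolev a b (n + r) p, ∀ k, lowerDeriv k y = u k := by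
  have h1 : ∀ (k : ℕ) (hk : k < r), HasWeakDeriv a b k (toLp (u ⟨0, hr⟩)) (toLp (u ⟨k, hk⟩)) := by
    intro k
    induction k with
    | zero => exact fun _ => hasWeakDeriv_zero_self _
    | succ k ih =>
      intro hk
      have h2 : HasWeakDeriv a b 1 (toLp (u ⟨k, by omega⟩))
          (weakDeriv ⟨1, by omega⟩ (u ⟨k, by omega⟩)) :=
        hasWeakDeriv_weakDeriv (⟨1, by omega⟩ : Fin (n + 1 + 1)) (u ⟨k, by omega⟩)
      have h3 := congrArg toLp (hu ⟨k, by omega⟩ hk)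
      rw [toLp_derivTo, toLp_derivTo_zero] at h3
      rw [h3] at h2
      exact (ih (by omega)).trans h2
  have hy : ∀ j ≤ n + r, ∃ z : LpI a b p, HasWeakDeriv a b j (toLp (u ⟨0, hr⟩)) z := by
    intro j hj
    rcases Nat.lt_or_ge j r with hjr | hjr
    · exact ⟨_, h1 j hjr⟩
    · obtain ⟨i, rfl⟩ := Nat.exists_eq_add_of_le (show r - 1 ≤ j by omega)
      exact ⟨_, (h1 (r - 1) (by omega)).trans
        (hasWeakDeriv_weakDeriv (⟨i, by omega⟩ : Fin (n + 1 + 1)) (u ⟨r - 1, by omega⟩))⟩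
  let y : Sobolev a b (n + r) p := (⟨toLp (u ⟨0, hr⟩), hy⟩ : sobolevSubmodule a b (n + r) p)
  exact ⟨y, fun k => toLp_injective (weakDeriv_eq_of_hasWeakDeriv (h1 k k.2))⟩

/-- The derivative of order `r` of a vector-valued function. -/
def topDerivVec : SobolevVec a b (n + r) p m →L[ℂ] SobolevVec a b n p m :=
  (PiLp.continuousLinearEquiv 1 ℂ fun _ : Fin m => Sobolev a b n p).symm.toContinuousLinearMap ∘L
    ContinuousLinearMap.pi fun i =>
      topDeriv ∘L PiLp.proj 1 (fun _ : Fin m => Sobolev a b (n + r) p) i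

variable [hab : Fact (a < b)]

/-- The constant function `1`. -/
def one : Sobolev a b n p := derivTo 0 n (by omega) (integ ((0, 1) : Sobolev a b n p × ℂ))

theorem toLp_one_ae : toLp (one : Sobolev a b n p) =ᵐ[volume.restrict (Icc a b)] fun _ => 1 := by
  rw [one, toLp_derivTo_zero, toLp_integ]
  filter_upwards [coeFn_primLp (toLp (0 : Sobolev a b n p)) 1, ae_restrict_mem measurableSet_Icc]
    with t h ht
  rw [h, ← integralTo_apply ht, map_zero, map_zero, add_zero]

theorem one_mul (v : Sobolev a b (n + 1) p) : mul one v = derivTo 0 n (by omega) v := by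
  refine toLp_injective (Lp.ext ?_)
  rw [toLp_derivTo_zero]
  filter_upwards [isMul_mul one v, toLp_one_ae (a := a) (b := b) (n := n) (p := p)] with t h1 h2
  rw [h1, h2, _root_.one_mul]

/-- The terms of order less than `r` of the differential operator, as a bilinear operator of the
coefficients and the function. -/
def lowerTerms : (Fin r → SobolevMat a b n p m) →L[ℂ] SobolevVec a b (n + r) p m →L[ℂ]
    SobolevVec a b n p m :=
  ∑ i : Fin m, (ContinuousLinearMap.compL ℂ (SobolevVec a b (n + r) p m) (Sobolev a b n p)
      (SobolevVec a b n p m)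
      ((PiLp.continuousLinearEquiv 1 ℂ fun _ : Fin m => Sobolev a b n p).symm.toContinuousLinearMap
        ∘L ContinuousLinearMap.single ℂ (fun _ : Fin m => Sobolev a b n p) i)) ∘L
    ∑ k : Fin r, ∑ l : Fin m, mul.bilinearComp
      (PiLp.proj 1 (fun _ : Fin m × Fin m => Sobolev a b n p) (i, l) ∘L
        ContinuousLinearMap.proj k)
      (lowerDeriv k ∘L PiLp.proj 1 (fun _ : Fin m => Sobolev a b (n + r) p) l)

theorem lowerTerms_apply (A : Fin r → SobolevMat a b n p m) (y : SobolevVec a b (n + r) p m)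
    (i : Fin m) :
    lowerTerms A y i = ∑ k, ∑ l, mul (A k (i, l)) (lowerDeriv k (y l)) := by
  simp only [lowerTerms, _root_.sum_apply, ContinuousLinearMap.comp_apply,
    ContinuousLinearMap.compL_apply, WithLp.ofLp_sum, Finset.sum_apply]
  rw [Finset.sum_eq_single i]
  · simp
  · intro j _ hj
    simp [hj.symm]
  · simp

/-- The differential operator with the coefficients `A`. -/
def diffOp (A : Fin r → SobolevMat a b n p m) :
    SobolevVec a b (n + r) p m →L[ℂ] SobolevVec a b n p m :=
  topDerivVec + lowerTerms A

theorem diffOp_apply (A : Fin r → SobolevMat a b n p m) (y : SobolevVec a b (n + r) p m)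
    (i : Fin m) :
    diffOp A y i = topDeriv (y i) + ∑ k, ∑ l, mul (A k (i, l)) (lowerDeriv k (y l)) := by
  rw [← lowerTerms_apply]
  rfl

theorem isSolution_iff (A : Fin r → SobolevMat a b n p m)
    (B : SobolevVec a b (n + r) p m →L[ℂ] EuclideanSpace ℂ (Fin (r * m)))
    (f : SobolevVec a b n p m) (c : EuclideanSpace ℂ (Fin (r * m)))
    (y : SobolevVec a b (n + r) p m) :
    IsSolution A B f c y ↔ diffOp A y = f ∧ B y = c := by
  have hop : ∀ i, toLp (diffOp A y i) =ᵐ[volume.restrict (Icc a b)] fun t =>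
      weakDeriv ⟨r, by omega⟩ (y i) t + ∑ k : Fin r, ∑ l : Fin m,
        toLp (A k (i, l)) t * weakDeriv ⟨k, by omega⟩ (y l) t := by
    intro i
    have h1 := ae_all_iff.2 fun k : Fin r =>
      toLp_sum_ae Finset.univ fun l => mul (A k (i, l)) (lowerDeriv k (y l))
    have h2 := toLp_sum_ae Finset.univ fun k : Fin r =>
      ∑ l, mul (A k (i, l)) (lowerDeriv k (y l))
    have h3 := ae_all_iff.2 fun k : Fin r => ae_all_iff.2 fun l : Fin m =>
      isMul_mul (A k (i, l)) (lowerDeriv k (y l))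
    rw [diffOp_apply, map_add]
    filter_upwards [h1, h2, h3, Lp.coeFn_add (toLp (topDeriv (y i)))
      (toLp (∑ k, ∑ l, mul (A k (i, l)) (lowerDeriv k (y l))))] with t h1 h2 h3 h4
    rw [h4, Pi.add_apply, h2]
    congr 1
    refine Finset.sum_congr rfl fun k _ => ?_
    rw [h1 k]
    exact Finset.sum_congr rfl fun l _ => h3 k l
  rw [IsSolution]
  refine and_congr_left fun _ => ?_
  constructor
  · intro h
    ext1 i
    refine toLp_injective (Lp.ext ?_)
    filter_upwards [h, hop i] with t h1 h2
    rw [h2, h1 i]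
  · rintro rfl
    filter_upwards [ae_all_iff.2 hop] with t h i
    rw [h i]

/-- The initial values at `a` of a function and its derivatives of orders less than `r`. -/
def cauchyData : SobolevVec a b (n + r) p m →L[ℂ] (Fin r × Fin m → ℂ) :=
  ContinuousLinearMap.pi fun q =>
    val ∘L lowerDeriv q.1 ∘L PiLp.proj 1 (fun _ : Fin m => Sobolev a b (n + r) p) q.2

/-- The matrix of the first-order system to which an equation of order `r` is equivalent. -/
def companion (A : Fin r → SobolevMat a b n p m) (q q' : Fin r × Fin m) : Sobolev a b n p :=
  if h : (q.1 : ℕ) + 1 < r then (if q' = (⟨q.1 + 1, h⟩, q.2) then one else 0)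
  else -A q'.1 (q.2, q'.2)

/-- The right-hand side of the first-order system to which an equation of order `r` is
equivalent. -/
def companionRhs (f : SobolevVec a b n p m) (q : Fin r × Fin m) : Sobolev a b n p :=
  if (q.1 : ℕ) + 1 < r then 0 else f q.2

theorem sum_companion_of_lt (A : Fin r → SobolevMat a b n p m) {q : Fin r × Fin m}
    (h : (q.1 : ℕ) + 1 < r) (u : Fin r × Fin m → Sobolev a b (n + 1) p) :
    ∑ q', mul (companion A q q') (u q') = derivTo 0 n (by omega) (u (⟨q.1 + 1, h⟩, q.2)) := by
  rw [Finset.sum_eq_single (⟨q.1 + 1, h⟩, q.2)]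
  · rw [companion, dif_pos h, if_pos rfl, one_mul]
  · intro q' _ hq'
    rw [companion, dif_pos h, if_neg hq', map_zero, zero_apply]
  · simp

theorem sum_companion_of_not_lt (A : Fin r → SobolevMat a b n p m) {q : Fin r × Fin m}
    (h : ¬ (q.1 : ℕ) + 1 < r) (u : Fin r × Fin m → Sobolev a b (n + 1) p) :
    ∑ q', mul (companion A q q') (u q') = -∑ k, ∑ l, mul (A k (q.2, l)) (u (k, l)) := by
  rw [Fintype.sum_prod_type, ← Finset.sum_neg_distrib]
  refine Finset.sum_congr rfl fun k _ => ?_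
  rw [← Finset.sum_neg_distrib]
  refine Finset.sum_congr rfl fun l _ => ?_
  rw [companion, dif_neg h, map_neg, neg_apply]

/-- For the tuple of derivatives of one function, all block rows but the last hold automatically;
the last one is the differential equation. -/
theorem isSystemSolution_companion_iff (hr : 1 ≤ r) (A : Fin r → SobolevMat a b n p m)
    (f : SobolevVec a b n p m) (c : Fin r × Fin m → ℂ) (y : SobolevVec a b (n + r) p m) :
    IsSystemSolution (companion A) (companionRhs f) c (fun q => lowerDeriv q.1 (y q.2)) ↔
      diffOp A y = f ∧ cauchyData y = c := by
  constructor
  · intro h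
    refine ⟨?_, funext fun q => (h q).2⟩
    ext1 i
    have hlast : ¬ ((⟨r - 1, by omega⟩ : Fin r) : ℕ) + 1 < r := by simp; omega
    have h1 := (h (⟨r - 1, by omega⟩, i)).1
    rw [derivTo_lowerDeriv_of_not_lt hlast, sum_companion_of_not_lt _ hlast, companionRhs,
      if_neg hlast] at h1
    rw [diffOp_apply, h1]
    simp
  · rintro ⟨rfl, rfl⟩ q
    refine ⟨?_, rfl⟩
    by_cases hq : (q.1 : ℕ) + 1 < r
    · rw [derivTo_lowerDeriv_of_lt hq, sum_companion_of_lt _ hq, companionRhs, if_pos hq, add_zero]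
    · rw [derivTo_lowerDeriv_of_not_lt hq, sum_companion_of_not_lt _ hq, companionRhs, if_neg hq,
        diffOp_apply]
      simp

/-- The Cauchy problem is uniquely solvable. -/
theorem bijective_diffOp_prod_cauchyData (hr : 1 ≤ r) (A : Fin r → SobolevMat a b n p m) :
    Function.Bijective ((diffOp A).prod cauchyData) := by
  constructor
  · intro y y' h
    have h1 := (isSystemSolution_companion_iff hr A (diffOp A y) (cauchyData y) y).2 ⟨rfl, rfl⟩
    have h2 := (isSystemSolution_companion_iff hr A (diffOp A y) (cauchyData y) y').2
      ⟨(congrArg Prod.fst h).symm, (congrArg Prod.snd h).symm⟩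
    have h3 := h1.unique h2
    ext1 i
    exact eq_of_lowerDeriv_eq hr (congrFun h3 (⟨0, hr⟩, i))
  · rintro ⟨f, c⟩
    obtain ⟨z, hz⟩ := exists_isSystemSolution (companion A) (companionRhs f) c
    -- Conversely, the block rows before the last say that the components of a system solution are
    -- successive derivatives.
    have hchain : ∀ i, ∃ y : Sobolev a b (n + r) p, ∀ k, lowerDeriv k y = z (k, i) := by
      refine fun i => exists_lowerDeriv_eq hr _ fun k hk => ?_
      have h1 := (hz (k, i)).1
      rwa [sum_companion_of_lt A (q := (k, i)) hk, companionRhs, if_pos hk, add_zero] at h1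
    choose y hy using hchain
    have hzy : z = fun q => lowerDeriv q.1 ((WithLp.toLp 1 y : SobolevVec a b (n + r) p m) q.2) :=
      funext fun q => (hy q.2 q.1).symm
    rw [hzy] at hz
    obtain ⟨h1, h2⟩ := (isSystemSolution_companion_iff hr A f c _).1 hz
    exact ⟨_, Prod.ext h1 h2⟩

end Sobolev

/-! ### Recovering the coefficients from a fundamental system of solutions -/

namespace Sobolev

variable {a b : ℝ} {n m r : ℕ} {p : ℝ≥0∞} [Fact (1 ≤ p)] [hab : Fact (a < b)]

section System

variable {ι : Type*} [Fintype ι]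

theorem IsSystemSolution.weakDeriv_ae {F : ι → ι → Sobolev a b n p} {z₀ : ι → ℂ}
    {z : ι → Sobolev a b (n + 1) p} (hz : IsSystemSolution F (fun _ => 0) z₀ z) (i : ι) :
    weakDeriv ⟨1, by omega⟩ (z i) =ᵐ[volume.restrict (Icc a b)]
      fun t => ∑ j, toLp (F i j) t * rep (z j) t := by
  have h := congrArg toLp (hz i).1
  rw [toLp_derivTo, add_zero] at h
  rw [h]
  filter_upwards [toLp_sum_ae Finset.univ fun j => mul (F i j) (z j),
    ae_all_iff.2 fun j => isMul_mul (F i j) (z j), ae_all_iff.2 fun j => toLp_ae_eq_rep (z j)]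
    with t h1 h2 h3
  rw [h1]
  exact Finset.sum_congr rfl fun j _ => by rw [h2, h3]

/-- The pairing of solutions of a linear system and of the adjoint system is constant. -/
theorem IsSystemSolution.sum_rep_mul_rep {F : ι → ι → Sobolev a b n p} {z₀ w₀ : ι → ℂ}
    {z w : ι → Sobolev a b (n + 1) p} (hz : IsSystemSolution F (fun _ => 0) z₀ z)
    (hw : IsSystemSolution (fun i j => -F j i) (fun _ => 0) w₀ w) {t : ℝ} (ht : t ∈ Icc a b) :
    ∑ i, rep (w i) t * rep (z i) t = ∑ i, w₀ i * z₀ i := by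
  have ha : a ∈ Icc a b := ⟨le_rfl, hab.out.le⟩
  have hp := fun i => (isPrimitiveOn_rep (w i)).mul (isPrimitiveOn_rep (z i)) hab.out.le
  have h1 : ∀ i, rep (w i) t * rep (z i) t = w₀ i * z₀ i +
      ∫ s in a..t, (weakDeriv ⟨1, by omega⟩ (w i) s * rep (z i) s +
        rep (w i) s * weakDeriv ⟨1, by omega⟩ (z i) s) := by
    intro i
    have h2 := (hp i).2 t ht
    beta_reduce at h2
    rw [h2, rep_left, rep_left, (hz i).2, (hw i).2]
  have h3 : (fun s => ∑ i, (weakDeriv ⟨1, by omega⟩ (w i) s * rep (z i) s +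
      rep (w i) s * weakDeriv ⟨1, by omega⟩ (z i) s)) =ᵐ[volume.restrict (Icc a b)]
      fun _ => 0 := by
    filter_upwards [ae_all_iff.2 fun i => hz.weakDeriv_ae i,
      ae_all_iff.2 fun i => hw.weakDeriv_ae i,
      ae_all_iff.2 fun i => ae_all_iff.2 fun j => toLp_neg_ae (F j i)] with s h4 h5 h6
    simp only [h4, h5, h6]
    rw [Finset.sum_add_distrib]
    simp only [Finset.sum_mul, Finset.mul_sum]
    -- The adjoint matrix is `-Fᵀ`, so exchanging the indices in one double sum makes the two cancel
    -- term by term.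
    rw [Finset.sum_comm, ← Finset.sum_add_distrib]
    refine Finset.sum_eq_zero fun i _ => ?_
    rw [← Finset.sum_add_distrib]
    exact Finset.sum_eq_zero fun j _ => by ring
  rw [Finset.sum_congr rfl fun i _ => h1 i, Finset.sum_add_distrib,
    ← intervalIntegral.integral_finsetSum fun i _ => (hp i).1.intervalIntegrable_of_mem_Icc ha ht,
    intervalIntegral_congr_Lp h3 ht]
  simp

/-- A fundamental matrix of a linear system has an inverse in the Sobolev space. -/
theorem exists_inverse_of_isSystemSolution [DecidableEq ι] {F : ι → ι → Sobolev a b n p}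
    {c : ι → ι → ℂ} {z : ι → ι → Sobolev a b (n + 1) p}
    (hz : ∀ j, IsSystemSolution F (fun _ => 0) (c j) (z j))
    (hc : IsUnit (Matrix.of fun i j => c j i).det) :
    ∃ w : ι → ι → Sobolev a b (n + 1) p, ∀ t ∈ Icc a b, ∀ i k,
      ∑ j, rep (z j i) t * rep (w j k) t = if i = k then 1 else 0 := by
  -- The adjoint solutions start from the rows of the inverse initial matrix. Constancy of the
  -- pairing makes them a left inverse at every `t`, and for square matrices a left inverse is a
  -- right inverse.
  choose w hw using fun q => exists_isSystemSolution (fun i j => -F j i) (fun _ => 0)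
    ((Matrix.of fun i j => c j i)⁻¹ q)
  refine ⟨w, fun t ht => ?_⟩
  have h1 : (Matrix.of fun q i => rep (w q i) t) * (Matrix.of fun i j => rep (z j i) t) = 1 := by
    ext q j
    rw [← Matrix.nonsing_inv_mul _ hc, Matrix.mul_apply, Matrix.mul_apply]
    exact (hz j).sum_rep_mul_rep (hw q) ht
  rw [mul_eq_one_comm] at h1
  intro i k
  have h2 := congrFun (congrFun h1 i) k
  rwa [Matrix.mul_apply, Matrix.one_apply] at h2

end System

/-- The coefficients are controlled by the values of the operator on a fundamental system. -/
theorem exists_norm_le_sum_norm_lowerTerms (hr : 1 ≤ r) {A₀ : Fin r → SobolevMat a b n p m}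
    {y : Fin r × Fin m → SobolevVec a b (n + r) p m} (hy : ∀ j, diffOp A₀ (y j) = 0)
    (hdet : IsUnit (Matrix.of fun i j => cauchyData (y j) i).det) :
    ∃ C : ℝ, 0 ≤ C ∧ ∀ A : Fin r → SobolevMat a b n p m,
      ‖A‖ ≤ C * ∑ j, ‖lowerTerms A (y j)‖ := by
  have hz : ∀ j, IsSystemSolution (companion A₀) (fun _ => 0) (cauchyData (y j))
      fun q => lowerDeriv q.1 (y j q.2) := by
    intro j
    have h := (isSystemSolution_companion_iff hr A₀ 0 (cauchyData (y j)) (y j)).2 ⟨hy j, rfl⟩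
    have h0 : companionRhs (r := r) (0 : SobolevVec a b n p m) = fun _ => 0 := by
      funext q; simp [companionRhs]
    rwa [h0] at h
  obtain ⟨w, hw⟩ := exists_inverse_of_isSystemSolution hz hdet
  -- The lower-order terms on the `y j` form the row of coefficients times the Wronskian matrix;
  -- multiplying by the inverse matrix `w` isolates one coefficient.
  have key : ∀ (A : Fin r → SobolevMat a b n p m) (k : Fin r) (i l : Fin m),
      A k (i, l) = ∑ j, mul (lowerTerms A (y j) i) (w j (k, l)) := by
    intro A k i l
    refine toLp_injective (Lp.ext ?_)
    have h1 := ae_all_iff.2 fun j => isMul_mul (lowerTerms A (y j) i) (w j (k, l))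
    have h2 := ae_all_iff.2 fun j => toLp_sum_ae Finset.univ fun q : Fin r × Fin m =>
      mul (A q.1 (i, q.2)) (lowerDeriv q.1 (y j q.2))
    have h3 := ae_all_iff.2 fun j => ae_all_iff.2 fun q : Fin r × Fin m =>
      isMul_mul (A q.1 (i, q.2)) (lowerDeriv q.1 (y j q.2))
    have h4 := ae_all_iff.2 fun j => ae_all_iff.2 fun q : Fin r × Fin m =>
      toLp_ae_eq_rep (lowerDeriv q.1 (y j q.2))
    have h5 := ae_all_iff.2 fun j => toLp_ae_eq_rep (w j (k, l))
    have h6 : ∀ j, lowerTerms A (y j) i =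
        ∑ q : Fin r × Fin m, mul (A q.1 (i, q.2)) (lowerDeriv q.1 (y j q.2)) := by
      intro j
      rw [lowerTerms_apply, Fintype.sum_prod_type]
    filter_upwards [toLp_sum_ae Finset.univ fun j => mul (lowerTerms A (y j) i) (w j (k, l)),
      h1, h2, h3, h4, h5, ae_restrict_mem measurableSet_Icc] with t h0 h1 h2 h3 h4 h5 ht
    rw [h0]
    simp only [h1, h5]
    simp only [h6, h2, h3, h4, Finset.sum_mul]
    rw [Finset.sum_comm]
    simp only [mul_assoc, ← Finset.mul_sum]
    rw [Finset.sum_eq_single (k, l)]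
    · rw [hw t ht (k, l) (k, l), if_pos rfl, mul_one]
    · intro q _ hq
      rw [hw t ht q (k, l), if_neg hq, mul_zero]
    · simp
  let K : ℝ := ∑ j, ∑ q, ‖(mul : Sobolev a b n p →L[ℂ] _)‖ * ‖w j q‖
  have hK : ∀ j q, ‖(mul : Sobolev a b n p →L[ℂ] _)‖ * ‖w j q‖ ≤ K := fun j q =>
    (Finset.single_le_sum (f := fun q => ‖(mul : Sobolev a b n p →L[ℂ] _)‖ * ‖w j q‖)
      (fun _ _ => by positivity) (Finset.mem_univ q)).trans
      (Finset.single_le_sum (f := fun j => ∑ q, ‖(mul : Sobolev a b n p →L[ℂ] _)‖ * ‖w j q‖)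
        (fun _ _ => Finset.sum_nonneg fun _ _ => by positivity) (Finset.mem_univ j))
  have hK0 : 0 ≤ K := Finset.sum_nonneg fun _ _ => Finset.sum_nonneg fun _ _ => by positivity
  refine ⟨∑ _q : Fin m × Fin m, K, Finset.sum_nonneg fun _ _ => hK0, fun A => ?_⟩
  rw [pi_norm_le_iff_of_nonneg (mul_nonneg (Finset.sum_nonneg fun _ _ => hK0)
    (Finset.sum_nonneg fun _ _ => norm_nonneg _))]
  intro k
  rw [PiLp.norm_eq_of_L1, Finset.sum_mul]
  refine Finset.sum_le_sum fun q _ => ?_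
  rw [key A k q.1 q.2, Finset.mul_sum]
  refine (norm_sum_le _ _).trans (Finset.sum_le_sum fun j _ => ?_)
  refine (ContinuousLinearMap.le_opNorm₂ _ _ _).trans ?_
  rw [mul_right_comm]
  exact mul_le_mul (hK j _) (PiLp.norm_apply_le _ _) (norm_nonneg _) hK0

end Sobolev

/-! ### Strong convergence of operators -/

section Abstract

variable {X Y E Q : Type*} [NormedAddCommGroup X] [NormedSpace ℂ X] [NormedAddCommGroup Y]
  [NormedSpace ℂ Y] [NormedAddCommGroup E] [NormedSpace ℂ E]
  [NormedAddCommGroup Q] [NormedSpace ℂ Q] {α : Type*} {l : Filter α}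

/-- Convergence along a filter bounds each orbit only eventually, and the threshold depends on the
vector. A countable basis permits passing to a sequence with norms exceeding every `k`; its orbits
are bounded outright, which contradicts Banach–Steinhaus. -/
theorem exists_eventually_norm_le_of_tendsto [CompleteSpace X] [l.IsCountablyGenerated]
    {B : α → X →L[ℂ] E} {B₀ : X →L[ℂ] E} (hB : ∀ y, Tendsto (fun ε => B ε y) l (𝓝 (B₀ y))) :
    ∃ C : ℝ, ∀ᶠ ε in l, ‖B ε‖ ≤ C := by
  by_contra hcon
  push Not at hcon
  obtain ⟨s, hs⟩ := l.exists_antitone_basis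
  have h1 : ∀ k : ℕ, ∃ ε ∈ s k, (k : ℝ) < ‖B ε‖ := fun k => by
    simpa using hs.toHasBasis.frequently_iff.1 (hcon k) (i := k)
  choose u hu hu' using h1
  have hut : Tendsto u atTop l := hs.tendsto hu
  obtain ⟨C, hC⟩ := banach_steinhaus (g := fun k => B (u k)) fun y => by
    obtain ⟨C, hC⟩ := ((hB y).comp hut).norm.bddAbove_range
    exact ⟨C, fun k => hC (mem_range_self k)⟩
  obtain ⟨k, hk⟩ := exists_nat_gt C
  exact absurd ((hu' k).trans_le (hC k)) (not_lt.2 hk.le)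

theorem tendsto_apply_of_tendsto [CompleteSpace X] [l.IsCountablyGenerated]
    {B : α → X →L[ℂ] E} {B₀ : X →L[ℂ] E} (hB : ∀ y, Tendsto (fun ε => B ε y) l (𝓝 (B₀ y)))
    {x : α → X} {x₀ : X} (hx : Tendsto x l (𝓝 x₀)) :
    Tendsto (fun ε => B ε (x ε)) l (𝓝 (B₀ x₀)) := by
  obtain ⟨C, hC⟩ := exists_eventually_norm_le_of_tendsto hB
  have h1 : Tendsto (fun ε => B ε (x ε - x₀)) l (𝓝 0) := by
    have h2 : Tendsto (fun ε => C * ‖x ε - x₀‖) l (𝓝 0) := by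
      simpa using (tendsto_iff_norm_sub_tendsto_zero.1 hx).const_mul C
    refine squeeze_zero_norm' ?_ h2
    filter_upwards [hC] with ε hε
    exact (B ε).le_of_opNorm_le hε _
  simpa using h1.add (hB x₀)

/-- The operator norm is at most the sum of the norms of the values on the standard basis. -/
theorem tendsto_of_forall_tendsto_apply {ι : Type*} [Fintype ι] [DecidableEq ι]
    {M : α → (ι → ℂ) →L[ℂ] E} {M₀ : (ι → ℂ) →L[ℂ] E}
    (h : ∀ q, Tendsto (fun ε => M ε q) l (𝓝 (M₀ q))) : Tendsto M l (𝓝 M₀) := by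
  have hbound : ∀ N : (ι → ℂ) →L[ℂ] E, ‖N‖ ≤ ∑ i, ‖N (Pi.single i 1)‖ := by
    refine fun N => N.opNorm_le_bound (Finset.sum_nonneg fun _ _ => norm_nonneg _) fun q => ?_
    conv_lhs => rw [pi_eq_sum_univ' q]
    rw [map_sum, Finset.sum_mul]
    refine (norm_sum_le _ _).trans (Finset.sum_le_sum fun i _ => ?_)
    rw [map_smul, norm_smul, mul_comm]
    exact mul_le_mul_of_nonneg_left (norm_le_pi_norm q i) (norm_nonneg _)
  rw [tendsto_iff_norm_sub_tendsto_zero]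
  refine squeeze_zero (fun _ => norm_nonneg _) (fun ε => hbound _) ?_
  have h2 : ∀ i ∈ Finset.univ, Tendsto (fun ε => ‖(M ε - M₀) (Pi.single i 1)‖) l (𝓝 0) :=
    fun i _ => tendsto_iff_norm_sub_tendsto_zero.1 (h (Pi.single i 1))
  simpa using tendsto_finsetSum _ h2

/-- If `(L, γ)` and the restriction of `B` to `ker L` are invertible, then so is `(L, B)`. -/
theorem apply_eq_and_apply_eq_iff {L : X →L[ℂ] Y} {γ : X →L[ℂ] Q} {B : X →L[ℂ] E}
    {e : X ≃L[ℂ] Y × Q} (he : (e : X →L[ℂ] Y × Q) = L.prod γ) {e' : Q ≃L[ℂ] E}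
    (he' : ∀ q, e' q = B (e.symm (0, q))) {f : Y} {c : E} {y : X} :
    L y = f ∧ B y = c ↔ y = e.symm (f, e'.symm (c - B (e.symm (f, 0)))) := by
  have hey : ∀ y, e y = (L y, γ y) := fun y => congrArg (fun T : X →L[ℂ] Y × Q => T y) he
  have hsplit : ∀ f q, e.symm (f, q) = e.symm (f, 0) + e.symm (0, q) := by
    intro f q
    rw [← map_add, Prod.mk_add_mk, add_zero, zero_add]
  constructor
  · rintro ⟨rfl, rfl⟩
    rw [ContinuousLinearEquiv.eq_symm_apply, hey]
    congr 1
    rw [ContinuousLinearEquiv.eq_symm_apply, he', eq_sub_iff_add_eq', ← map_add, ← hsplit, ← hey,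
      ContinuousLinearEquiv.symm_apply_apply]
  · rintro rfl
    constructor
    · have h := hey (e.symm (f, e'.symm (c - B (e.symm (f, 0)))))
      rw [ContinuousLinearEquiv.apply_symm_apply] at h
      exact (congrArg Prod.fst h).symm
    · rw [hsplit, map_add, ← he', ContinuousLinearEquiv.apply_symm_apply, add_sub_cancel]

/-- A continuous linear bijection between Banach spaces is an isomorphism. -/
theorem exists_equiv_of_bijective [CompleteSpace X] [CompleteSpace Y] {T : X →L[ℂ] Y}
    (hT : Function.Bijective T) : ∃ e : X ≃L[ℂ] Y, (e : X →L[ℂ] Y) = T :=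
  ⟨ContinuousLinearEquiv.ofBijective T (LinearMap.ker_eq_bot.2 hT.1)
    (LinearMap.range_eq_top.2 hT.2), rfl⟩

theorem tendsto_inverse [CompleteSpace X] {T : α → X →L[ℂ] Y} (e : X ≃L[ℂ] Y)
    (hT : Tendsto T l (𝓝 (e : X →L[ℂ] Y))) :
    Tendsto (fun ε => (T ε).inverse) l (𝓝 (e.symm : Y →L[ℂ] X)) := by
  have h := (contDiffAt_map_inverse (n := 0) e).continuousAt.tendsto.comp hT
  rwa [ContinuousLinearMap.inverse_equiv] at h

/-- Boundary-value problems that converge strongly to a uniquely solvable one are eventually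
uniquely solvable and their solutions converge. -/
theorem bijective_and_tendsto_of_tendsto [CompleteSpace X] [CompleteSpace Y] [CompleteSpace E]
    {ι : Type*} [Fintype ι] [DecidableEq ι] [l.IsCountablyGenerated]
    {L : α → X →L[ℂ] Y} {L₀ : X →L[ℂ] Y} {B : α → X →L[ℂ] E} {B₀ : X →L[ℂ] E}
    {γ : X →L[ℂ] (ι → ℂ)} (hL : Tendsto L l (𝓝 L₀))
    (hB : ∀ y, Tendsto (fun ε => B ε y) l (𝓝 (B₀ y)))
    (hγ : Function.Bijective (L₀.prod γ)) (h0 : ∀ y, L₀ y = 0 → B₀ y = 0 → y = 0)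
    [FiniteDimensional ℂ E] (hdim : Module.finrank ℂ (ι → ℂ) = Module.finrank ℂ E) :
    (∀ᶠ ε in l, ∀ f c, ∃! y, L ε y = f ∧ B ε y = c) ∧ (∀ f c, ∃! y, L₀ y = f ∧ B₀ y = c) ∧
    ∀ (f : α → Y) (c : α → E) (y : α → X) (f₀ : Y) (c₀ : E) (y₀ : X),
      (∀ᶠ ε in l, L ε (y ε) = f ε ∧ B ε (y ε) = c ε) → L₀ y₀ = f₀ ∧ B₀ y₀ = c₀ →
      Tendsto f l (𝓝 f₀) → Tendsto c l (𝓝 c₀) → Tendsto y l (𝓝 y₀) := by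
  obtain ⟨e, he⟩ := exists_equiv_of_bijective hγ
  have hey : ∀ y, e y = (L₀ y, γ y) := fun y =>
    congrArg (fun T : X →L[ℂ] Y × (ι → ℂ) => T y) he
  let P : α → X →L[ℂ] Y × (ι → ℂ) := fun ε => (L ε).prod γ
  have hP : Tendsto P l (𝓝 (e : X →L[ℂ] Y × (ι → ℂ))) := by
    rw [he, tendsto_iff_norm_sub_tendsto_zero]
    refine squeeze_zero (fun _ => norm_nonneg _) (fun ε => ?_)
      (tendsto_iff_norm_sub_tendsto_zero.1 hL)
    refine ContinuousLinearMap.opNorm_le_bound _ (norm_nonneg _) fun y => ?_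
    have : (P ε - L₀.prod γ) y = ((L ε - L₀) y, 0) := by
      simp [P]
    rw [this, Prod.norm_def, norm_zero, max_eq_left (norm_nonneg _)]
    exact ContinuousLinearMap.le_opNorm _ _
  have hT := tendsto_inverse e hP
  let inr : (ι → ℂ) →L[ℂ] Y × (ι → ℂ) := ContinuousLinearMap.inr ℂ Y (ι → ℂ)
  -- Once `P ε` is invertible, this is the boundary operator on `ker (L ε)`, expressed in Cauchy
  -- data; its invertibility decides solvability.
  let M : α → (ι → ℂ) →L[ℂ] E := fun ε => B ε ∘L (P ε).inverse ∘L inr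
  let M₀ : (ι → ℂ) →L[ℂ] E := B₀ ∘L (e.symm : Y × (ι → ℂ) →L[ℂ] X) ∘L inr
  have happly : ∀ {w : α → Y × (ι → ℂ)} {w₀}, Tendsto w l (𝓝 w₀) →
      Tendsto (fun ε => (P ε).inverse (w ε)) l (𝓝 (e.symm w₀)) := fun hw =>
    (isBoundedBilinearMap_apply.continuous.tendsto _).comp (hT.prodMk_nhds hw)
  have hM : Tendsto M l (𝓝 M₀) := tendsto_of_forall_tendsto_apply fun q =>
    tendsto_apply_of_tendsto hB (happly tendsto_const_nhds)
  have hM₀ : Function.Injective M₀ := by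
    rw [injective_iff_map_eq_zero]
    intro q hq
    have h1 := hey (e.symm (0, q))
    rw [ContinuousLinearEquiv.apply_symm_apply] at h1
    have h2 := h0 _ (congrArg Prod.fst h1).symm hq
    rw [h2, map_zero] at h1
    simpa using congrArg Prod.snd h1
  obtain ⟨e', he'⟩ := exists_equiv_of_bijective (T := M₀)
    ⟨hM₀, (LinearMap.injective_iff_surjective_of_finrank_eq_finrank hdim
      (f := (M₀ : (ι → ℂ) →ₗ[ℂ] E))).1 hM₀⟩
  have hN := tendsto_inverse e' (he'.symm ▸ hM)
  have hgood : ∀ᶠ ε in l, ∀ f c y, L ε y = f ∧ B ε y = c ↔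
      y = (P ε).inverse (f, (M ε).inverse (c - B ε ((P ε).inverse (f, 0)))) := by
    have hM' : Tendsto M l (𝓝 (e' : (ι → ℂ) →L[ℂ] E)) := he'.symm ▸ hM
    -- Isomorphisms form an open set, so eventually `inverse` is a true inverse and not its default
    -- value.
    filter_upwards [hP (ContinuousLinearEquiv.nhds e), hM' (ContinuousLinearEquiv.nhds e')]
      with ε h1 h2 f c y
    obtain ⟨e1, h1⟩ := h1
    obtain ⟨e2, h2⟩ := h2
    rw [← h1, ← h2, ContinuousLinearMap.inverse_equiv, ContinuousLinearMap.inverse_equiv]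
    refine apply_eq_and_apply_eq_iff h1 fun q => ?_
    have h3 := congrArg (fun T : (ι → ℂ) →L[ℂ] E => T q) h2
    refine h3.trans ?_
    simp only [M, ContinuousLinearMap.comp_apply, ← h1, ContinuousLinearMap.inverse_equiv]
    rfl
  have hgood₀ : ∀ f c y, L₀ y = f ∧ B₀ y = c ↔
      y = e.symm (f, e'.symm (c - B₀ (e.symm (f, 0)))) := fun f c y =>
    apply_eq_and_apply_eq_iff he fun q => congrArg (fun T : (ι → ℂ) →L[ℂ] E => T q) he'
  refine ⟨?_, fun f c => ⟨_, (hgood₀ f c _).2 rfl, fun y hy => (hgood₀ f c y).1 hy⟩, ?_⟩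
  · filter_upwards [hgood] with ε hε f c
    exact ⟨_, (hε f c _).2 rfl, fun y hy => (hε f c y).1 hy⟩
  · intro f c y f₀ c₀ y₀ hy hy₀ hf hc
    rw [(hgood₀ f₀ c₀ y₀).1 hy₀]
    have h1 : Tendsto (fun ε => (P ε).inverse
        (f ε, (M ε).inverse (c ε - B ε ((P ε).inverse (f ε, 0))))) l
        (𝓝 (e.symm (f₀, e'.symm (c₀ - B₀ (e.symm (f₀, 0)))))) := by
      refine happly (hf.prodMk_nhds
        ((isBoundedBilinearMap_apply.continuous.tendsto _).comp (hN.prodMk_nhds (hc.sub ?_))))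
      exact tendsto_apply_of_tendsto hB (happly (hf.prodMk_nhds tendsto_const_nhds))
    refine h1.congr' ?_
    filter_upwards [hgood, hy] with ε h2 h3 using ((h2 _ _ _).1 h3).symm

/-- If the solutions of `D y + β(A, y) = 0` in a family that determines `A` converge, then so do
the coefficients. -/
theorem tendsto_of_tendsto_solutions {W κ : Type*} [NormedAddCommGroup W] [NormedSpace ℂ W]
    [Fintype κ] {D : X →L[ℂ] Y} {β : W →L[ℂ] X →L[ℂ] Y} {A : α → W} {A₀ : W}
    {y : α → κ → X} {y₀ : κ → X} (hy : ∀ j, Tendsto (fun ε => y ε j) l (𝓝 (y₀ j)))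
    (heq : ∀ᶠ ε in l, ∀ j, D (y ε j) + β (A ε) (y ε j) = 0)
    (heq₀ : ∀ j, D (y₀ j) + β A₀ (y₀ j) = 0) {C : ℝ} (hC0 : 0 ≤ C)
    (hC : ∀ δ : W, ‖δ‖ ≤ C * ∑ j, ‖β δ (y₀ j)‖) : Tendsto A l (𝓝 A₀) := by
  rw [tendsto_iff_norm_sub_tendsto_zero]
  have hη : Tendsto (fun ε => ∑ j, ‖y ε j - y₀ j‖) l (𝓝 0) := by
    simpa using tendsto_finsetSum Finset.univ fun j _ =>
      tendsto_iff_norm_sub_tendsto_zero.1 (hy j)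
  have hlim : Tendsto (fun ε => 2 * (C * ((‖β A₀‖ + ‖D‖) * ∑ j, ‖y ε j - y₀ j‖))) l (𝓝 0) := by
    simpa using ((hη.const_mul (‖β A₀‖ + ‖D‖)).const_mul C).const_mul 2
  -- No bound on `A ε` is known beforehand. The term with `‖A ε - A₀‖` on the right gets a factor
  -- below `1/2` and is absorbed on the left, whence the factor `2` in `hlim`.
  have hsmall : ∀ᶠ ε in l, C * ‖β‖ * ∑ j, ‖y ε j - y₀ j‖ < 1 / 2 := by
    have : Tendsto (fun ε => C * ‖β‖ * ∑ j, ‖y ε j - y₀ j‖) l (𝓝 0) := by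
      simpa using hη.const_mul (C * ‖β‖)
    exact this.eventually_lt_const (by norm_num)
  refine squeeze_zero' (Eventually.of_forall fun _ => norm_nonneg _) ?_ hlim
  filter_upwards [heq, hsmall] with ε h1 h2
  have h3 : ∀ j, ‖β (A ε - A₀) (y₀ j)‖ ≤
      (‖β‖ * ‖A ε - A₀‖ + (‖β A₀‖ + ‖D‖)) * ‖y ε j - y₀ j‖ := by
    intro j
    have h4 : β (A ε - A₀) (y₀ j) =
        -(β (A ε - A₀) (y ε j - y₀ j) + β A₀ (y ε j - y₀ j) + D (y ε j - y₀ j)) := by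
      have e1 := h1 j
      have e2 := heq₀ j
      rw [← eq_neg_iff_add_eq_zero] at e1 e2
      simp only [map_sub, sub_apply, e1, e2]
      abel
    rw [h4, norm_neg, add_mul, add_mul]
    refine (norm_add_le _ _).trans ?_
    rw [← add_assoc]
    refine add_le_add ((norm_add_le _ _).trans (add_le_add ?_ ?_)) ?_
    · exact ContinuousLinearMap.le_opNorm₂ _ _ _
    · exact ContinuousLinearMap.le_opNorm _ _
    · exact ContinuousLinearMap.le_opNorm _ _
  have h5 : ‖A ε - A₀‖ ≤ C * ((‖β‖ * ‖A ε - A₀‖ + (‖β A₀‖ + ‖D‖)) * ∑ j, ‖y ε j - y₀ j‖) := by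
    refine (hC _).trans (mul_le_mul_of_nonneg_left ?_ hC0)
    rw [Finset.mul_sum]
    exact Finset.sum_le_sum fun j _ => h3 j
  have h6 : C * ‖β‖ * (∑ j, ‖y ε j - y₀ j‖) * ‖A ε - A₀‖ ≤ 1 / 2 * ‖A ε - A₀‖ :=
    mul_le_mul_of_nonneg_right h2.le (norm_nonneg _)
  nlinarith [h5, h6]

/-- If the operators `S ε` on a finite-dimensional space converge to an injective one, then
`S ε (x ε) → 0` implies `x ε → 0`. -/
theorem tendsto_zero_of_tendsto_apply_zero {ι : Type*} [Fintype ι] [DecidableEq ι]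
    {S : α → (ι → ℂ) →L[ℂ] X} {S₀ : (ι → ℂ) →L[ℂ] X}
    (hS : ∀ q, Tendsto (fun ε => S ε q) l (𝓝 (S₀ q))) (hinj : Function.Injective S₀)
    {x : α → ι → ℂ} (hx : Tendsto (fun ε => S ε (x ε)) l (𝓝 0)) : Tendsto x l (𝓝 0) := by
  have hS' := tendsto_of_forall_tendsto_apply hS
  obtain ⟨K, hK0, hK⟩ := S₀.toLinearMap.exists_antilipschitzWith (LinearMap.ker_eq_bot.2 hinj)
  -- An injective map on a finite-dimensional space is bounded below; a perturbation of small norm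
  -- keeps this with a factor `2`.
  have hK' : ∀ q, ‖q‖ ≤ K * ‖S₀ q‖ := fun q => by
    simpa using hK.le_mul_dist q 0
  have hsmall : ∀ᶠ ε in l, K * ‖S ε - S₀‖ < 1 / 2 := by
    have : Tendsto (fun ε => K * ‖S ε - S₀‖) l (𝓝 0) := by
      simpa using (tendsto_iff_norm_sub_tendsto_zero.1 hS').const_mul (K : ℝ)
    exact this.eventually_lt_const (by norm_num)
  have hlim : Tendsto (fun ε => 2 * (K * ‖S ε (x ε)‖)) l (𝓝 0) := by
    simpa using (hx.norm.const_mul (K : ℝ)).const_mul 2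
  refine squeeze_zero_norm' ?_ hlim
  filter_upwards [hsmall] with ε hε
  have h1 : ‖S₀ (x ε)‖ ≤ ‖S ε (x ε)‖ + ‖S ε - S₀‖ * ‖x ε‖ := by
    have h2 : S₀ (x ε) = S ε (x ε) - (S ε - S₀) (x ε) := by simp
    rw [h2]
    exact (norm_sub_le _ _).trans (by gcongr; exact ContinuousLinearMap.le_opNorm _ _)
  have h3 := mul_le_mul_of_nonneg_left h1 K.coe_nonneg
  have h4 := mul_le_mul_of_nonneg_right hε.le (norm_nonneg (x ε))
  have h5 := hK' (x ε)
  rw [mul_add, ← mul_assoc] at h3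
  linarith

end Abstract

/-! ### Continuous dependence on the parameter -/

namespace Sobolev

variable {a b : ℝ} {n m r : ℕ} {p : ℝ≥0∞} [Fact (1 ≤ p)] [hab : Fact (a < b)]

theorem tendsto_diffOp {A : ℝ → Fin r → SobolevMat a b n p m} (hA : LimitConditionI A) :
    Tendsto (fun ε => diffOp (A ε)) (𝓝[>] 0) (𝓝 (diffOp (A 0))) :=
  ((lowerTerms.continuous.tendsto (A 0)).comp (tendsto_pi_nhds.2 hA)).const_add topDerivVec

theorem solutionDependsContinuously_of_conditions (hr : 1 ≤ r) {ε₀ : ℝ} (hε₀ : 0 < ε₀)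
    {A : ℝ → Fin r → SobolevMat a b n p m}
    {B : ℝ → SobolevVec a b (n + r) p m →L[ℂ] EuclideanSpace ℂ (Fin (r * m))}
    (h0 : ConditionZero A B) (hI : LimitConditionI A) (hII : LimitConditionII B) :
    SolutionDependsContinuously ε₀ A B := by
  obtain ⟨h1, h2, h3⟩ := bijective_and_tendsto_of_tendsto (tendsto_diffOp hI) hII
    (bijective_diffOp_prod_cauchyData hr (A 0))
    (fun y hy hy' => h0 y ((isSolution_iff _ _ _ _ _).2 ⟨hy, hy'⟩)) (by simp)
  obtain ⟨u, hu, hsub⟩ := mem_nhdsGT_iff_exists_Ioo_subset.1 h1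
  -- Halving `ε₀` secures the strict inequality `ε₁ < ε₀`. The filter does not see `ε = 0`, which is
  -- therefore handled separately below.
  have hε₁ : 0 < min u (ε₀ / 2) := lt_min hu (by linarith)
  refine ⟨min u (ε₀ / 2), hε₁, (min_le_right _ _).trans_lt (by linarith), ?_, ?_⟩
  · intro ε hε f c
    simp only [isSolution_iff]
    rcases hε.1.eq_or_lt with rfl | hpos
    · exact h2 f c
    · exact hsub ⟨hpos, hε.2.trans_le (min_le_left _ _)⟩ f c
  · intro f c y hy hf hc
    simp only [isSolution_iff] at hy
    refine h3 f c y _ _ _ ?_ (hy 0 ⟨le_rfl, hε₁⟩) hf hc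
    filter_upwards [Ioo_mem_nhdsGT hε₁] with ε hε using hy ε ⟨hε.1.le, hε.2⟩

/-- The linear combinations of a finite family of functions. -/
def combination {ι X : Type*} [Fintype ι] [NormedAddCommGroup X] [NormedSpace ℂ X] (y : ι → X) :
    (ι → ℂ) →L[ℂ] X :=
  ∑ j, (ContinuousLinearMap.proj (R := ℂ) (φ := fun _ : ι => ℂ) j).smulRight (y j)

theorem combination_apply {ι X : Type*} [Fintype ι] [NormedAddCommGroup X] [NormedSpace ℂ X]
    (y : ι → X) (q : ι → ℂ) : combination y q = ∑ j, q j • y j := by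
  simp [combination]

theorem conditionZero_of_existsUnique {A : ℝ → Fin r → SobolevMat a b n p m}
    {B : ℝ → SobolevVec a b (n + r) p m →L[ℂ] EuclideanSpace ℂ (Fin (r * m))}
    (h : ∀ f c, ∃! y, diffOp (A 0) y = f ∧ B 0 y = c) : ConditionZero A B := by
  intro y hy
  exact (h 0 0).unique ((isSolution_iff _ _ _ _ _).1 hy) ⟨map_zero _, map_zero _⟩

theorem conditions_of_solutionDependsContinuously (hr : 1 ≤ r) {ε₀ : ℝ}
    {A : ℝ → Fin r → SobolevMat a b n p m}
    {B : ℝ → SobolevVec a b (n + r) p m →L[ℂ] EuclideanSpace ℂ (Fin (r * m))}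
    (h : SolutionDependsContinuously ε₀ A B) :
    ConditionZero A B ∧ LimitConditionI A ∧ LimitConditionII B := by
  classical
  obtain ⟨ε₁, hε₁, -, hsol, hcont⟩ := h
  simp only [isSolution_iff] at hsol hcont
  have hmem : ∀ᶠ ε in 𝓝[>] (0 : ℝ), ε ∈ Ico 0 ε₁ := by
    filter_upwards [Ioo_mem_nhdsGT hε₁] with ε hε using ⟨hε.1.le, hε.2⟩
  have hmem₀ : (0 : ℝ) ∈ Ico 0 ε₁ := ⟨le_rfl, hε₁⟩
  let κ : (Fin r × Fin m → ℂ) ≃L[ℂ] EuclideanSpace ℂ (Fin (r * m)) :=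
    ContinuousLinearEquiv.ofFinrankEq (by simp)
  -- The solutions with homogeneous equation and basis boundary data; outside `[0, ε₁)` the value is
  -- arbitrary.
  have hfam : ∀ (ε : ℝ) (j : Fin r × Fin m), ∃ y, ε ∈ Ico 0 ε₁ →
      diffOp (A ε) y = 0 ∧ B ε y = κ (Pi.single j 1) := by
    intro ε j
    by_cases hε : ε ∈ Ico 0 ε₁
    · obtain ⟨y, hy, -⟩ := hsol ε hε 0 (κ (Pi.single j 1))
      exact ⟨y, fun _ => hy⟩
    · exact ⟨0, fun h => absurd h hε⟩
  choose y hy using hfam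
  have hylim : ∀ j, Tendsto (fun ε => y ε j) (𝓝[>] 0) (𝓝 (y 0 j)) := fun j =>
    hcont (fun _ => 0) (fun _ => κ (Pi.single j 1)) (fun ε => y ε j) (fun ε hε => hy ε j hε)
      tendsto_const_nhds tendsto_const_nhds
  have hcomb : ∀ ε ∈ Ico 0 ε₁, ∀ q, diffOp (A ε) (combination (y ε) q) = 0 ∧
      B ε (combination (y ε) q) = κ q := by
    intro ε hε q
    rw [combination_apply]
    simp only [map_sum, map_smul, (hy ε _ hε).1, (hy ε _ hε).2, smul_zero, Finset.sum_const_zero,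
      true_and]
    conv_rhs => rw [pi_eq_sum_univ' q]
    simp only [map_sum, map_smul]
  have hinj : Function.Injective (combination (y 0)) := by
    rw [injective_iff_map_eq_zero]
    intro q hq
    have h1 := (hcomb 0 hmem₀ q).2
    rw [hq, map_zero] at h1
    exact κ.injective (by rw [← h1, map_zero])
  -- A null vector would give a combination of the `y 0 j` with zero Cauchy data, which vanishes by
  -- uniqueness and contradicts `hinj`.
  have hdet : IsUnit (Matrix.of fun i j => cauchyData (y 0 j) i).det := by
    rw [isUnit_iff_ne_zero]
    intro hdet
    obtain ⟨v, hv0, hv⟩ := Matrix.exists_mulVec_eq_zero_iff.2 hdet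
    refine hv0 (hinj ?_)
    rw [map_zero]
    refine (bijective_diffOp_prod_cauchyData hr (A 0)).1 (Prod.ext ?_ ?_)
    · rw [map_zero]
      exact (hcomb 0 hmem₀ v).1
    · rw [map_zero]
      change cauchyData (combination (y 0) v) = 0
      rw [combination_apply, map_sum, ← hv]
      funext i
      simp [Matrix.mulVec, dotProduct, mul_comm]
  have hI : LimitConditionI A := by
    obtain ⟨C, hC0, hC⟩ := exists_norm_le_sum_norm_lowerTerms hr
      (fun j => (hy 0 j hmem₀).1) hdet
    refine tendsto_pi_nhds.1 (tendsto_of_tendsto_solutions (D := topDerivVec) (β := lowerTerms)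
      hylim ?_ (fun j => (hy 0 j hmem₀).1) hC0 hC)
    filter_upwards [hmem] with ε hε j using (hy ε j hε).1
  refine ⟨conditionZero_of_existsUnique (hsol 0 hmem₀), hI, fun x => ?_⟩
  -- Only the boundary data of `x` are altered, to a value independent of `ε`. Both data then
  -- converge without any knowledge of `B ε`, so continuous dependence applies.
  have hz : ∀ ε : ℝ, ∃ z, ε ∈ Ico 0 ε₁ → diffOp (A ε) z = diffOp (A ε) x ∧ B ε z = B 0 x := by
    intro ε
    by_cases hε : ε ∈ Ico 0 ε₁
    · obtain ⟨z, hz, -⟩ := hsol ε hε (diffOp (A ε) x) (B 0 x)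
      exact ⟨z, fun _ => hz⟩
    · exact ⟨0, fun h => absurd h hε⟩
  choose z hz using hz
  have hz0 : z 0 = x := (hsol 0 hmem₀ _ _).unique (hz 0 hmem₀) ⟨rfl, rfl⟩
  have hzlim : Tendsto z (𝓝[>] 0) (𝓝 x) := by
    have h1 := hcont (fun ε => diffOp (A ε) x) (fun _ => B 0 x) z hz
      ((ContinuousLinearMap.apply ℂ _ x).continuous.tendsto _ |>.comp (tendsto_diffOp hI))
      tendsto_const_nhds
    rwa [hz0] at h1
  have hS : ∀ q, Tendsto (fun ε => combination (y ε) q) (𝓝[>] 0) (𝓝 (combination (y 0) q)) := by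
    intro q
    simp only [combination_apply]
    exact tendsto_finsetSum _ fun j _ => (hylim j).const_smul (q j)
  -- By unique solvability this combination is `z ε - x`: both are annihilated by the differential
  -- operator and have boundary value `B 0 x - B ε x`.
  have hx : Tendsto (fun ε => combination (y ε) (κ.symm (B 0 x - B ε x))) (𝓝[>] 0) (𝓝 0) := by
    have h1 : Tendsto (fun ε => z ε - x) (𝓝[>] 0) (𝓝 0) := by
      simpa using hzlim.sub_const x
    refine h1.congr' ?_
    filter_upwards [hmem] with ε hε
    refine (hsol ε hε 0 (B 0 x - B ε x)).unique ⟨?_, ?_⟩ ⟨(hcomb ε hε _).1, ?_⟩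
    · rw [map_sub, (hz ε hε).1, sub_self]
    · rw [map_sub, (hz ε hε).2]
    · rw [(hcomb ε hε _).2, ContinuousLinearEquiv.apply_symm_apply]
  have hlim := tendsto_zero_of_tendsto_apply_zero hS hinj hx
  have h2 : Tendsto (fun ε => B 0 x - B ε x) (𝓝[>] 0) (𝓝 0) := by
    have h3 := (κ.continuous.tendsto 0).comp hlim
    simpa [Function.comp_def] using h3
  simpa using h2.const_sub (B 0 x)

end Sobolev

end

theorem theorem1 (n m r : ℕ) (hm : 1 ≤ m) (hr : 1 ≤ r) (p : ℝ≥0∞) [Fact (1 ≤ p)] (hp : p ≠ ⊤)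
    (a b : ℝ) (hab : a < b) (ε₀ : ℝ) (hε₀ : 0 < ε₀)
    (A : ℝ → Fin r → SobolevMat a b n p m)
    (B : ℝ → SobolevVec a b (n + r) p m →L[ℂ] EuclideanSpace ℂ (Fin (r * m))) :
    SolutionDependsContinuously ε₀ A B ↔
      ConditionZero A B ∧ LimitConditionI A ∧ LimitConditionII B := by
  have : Fact (a < b) := ⟨hab⟩
  exact ⟨Sobolev.conditions_of_solutionDependsContinuously hr, fun ⟨h0, hI, hII⟩ =>
    Sobolev.solutionDependsContinuously_of_conditions hr hε₀ h0 hI hII⟩
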